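/- Let $H$ be a (real, separable) Hilbert space with norm $\|\cdot\|$ and inner product $(\cdot,\cdot)$, let $k\in\mathbb R$ and $h>0$. Assume: (A1) $A$ is a positive self-adjoint operator in $H$ with domain $D(A)$ and discrete spectrum: there is an orthonormal basis $\{e_n\}_{n\ge 1}$ of $H$ with $Ae_n=\mu_n e_n$, $0<\mu_1\le\mu_2\le\dots$, $\mu_n\to\infty$. The space $D(A^{1/2})$ carries the norm $\|A^{1/2}u\|$. Put $$W=C([-h,0];D(A^{1/2}))\cap C^1([-h,0];H),\qquad |\varphi|_W=\max_{[-h,0]}\|A^{1/2}\varphi(\theta)\|+\max_{[-h,0]}\|\dot\varphi(\theta)\|.$$ (F1) $F:D(A^{1/2})\to H$ is locally Lipschitz: for every $R>0$ there is $L_R$ with $\|F(u_1)-F(u_2)\|\le L_R\|A^{1/2}(u_1-u_2)\|$ whenever $\|A^{1/2}u_i\|\le R$. (F2) $F=\Pi'+F^*$, where $\Pi'$ is the Fréchet derivative of a $C^1$-functional $\Pi=\Pi_0+\Pi_1:D(A^{1/2})\to\mathbb R$, i.e. $\langle\Pi'(u),v\rangle=(F(u)-F^*(u),v)$ for $u,v\in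 D(A^{1/2})$; $F^*:D(A^{1/2})\to H$ satisfies $\|F^*(u_1)-F^*(u_2)\|^2\le c_0\|A^{1/2}(u_1-u_2)\|^2$ for all $u_1,u_2$; $\Pi_0\ge 0$ is bounded on bounded subsets of $D(A^{1/2})$; and for every $\eta>0$ there is $C_\eta>0$ with $|\Pi_1(u)|\le\eta(\|A^{1/2}u\|^2+\Pi_0(u))+C_\eta$ for all $u\in D(A^{1/2})$. (M1) $M:W\to H$ is locally Lipschitz: for every $\varrho>0$ there is $C_\varrho$ with $\|M(\varphi_1)-M(\varphi_2)\|\le C_\varrho|\varphi_1-\varphi_2|_W$ whenever $|\varphi_j|_W\le\varrho$. (M2) There are $M_0,M_1\ge 0$ with $\|M(\varphi)\|\le M_0+M_1|\varphi|_W$ for all $\varphi\in W$. Consider the delay problem $$\ddot u(t)+k\dot u(t)+Au(t)+F(u(t))+M(u_t)=0,\quad t>0,\qquad u(\theta)=\varphi(\theta),\ \theta\in[-h,0],$$ where $u_t(\theta)=u(t+\theta)$ for $\theta\in[-h,0]$. The operator $-\mathcal A$, where $\mathcal A(u,v)=(-v,Au+kv)$ with $D(\mathcal A)=D(A)\times D(A^{1/2})$,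 generates a $C_0$-semigroup $e^{-t\mathcal A}$ in $Y=D(A^{1/2})\times H$. A mild solution on an interval $I$ of the form $[0,T]$, $[0,T)$ or $[0,\infty)$ is a function $u\in C([-h,0]\cup I;D(A^{1/2}))\cap C^1([-h,0]\cup I;H)$ with $u=\varphi$ on $[-h,0]$ such that $U(t)=(u(t),\dot u(t))$ satisfies, for $t\in I$, $$U(t)=e^{-t\mathcal A}U(0)+\int_0^t e^{-(t-s)\mathcal A}\bigl(0,\,-F(u(s))-M(u_s)\bigr)\,ds .$$ Then: 1. For every $\varphi\in W$ there is a unique mild solution on $[0,\infty)$. 2. Every mild solution satisfies, for all $t$ in its interval $I$, the energy equality $$\mathcal E(u(t),\dot u(t))+k\int_0^t\|\dot u(s)\|^2ds=\mathcal E(u(0),\dot u(0))-\int_0^t(F^*(u(s)),\dot u(s))\,ds-\int_0^t(M(u_s),\dot u(s))\,ds,$$ where $\mathcal E(u,v)=\tfrac12\left(\|v\|^2+\|A^{1/2}u\|^2\right)+\Pi_0(u)+\Pi_1(u)$. 3. For all $\varrho>0$ and $T>0$ there is $C_{\varrho,T}$ such that for any two mild solutions $u^1,u^2$ on a common interval $I$,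 with initial functions $\varphi^1,\varphi^2$ satisfying $|\varphi^j|_W\le\varrho$, $$\|A^{1/2}(u^1(t)-u^2(t))\|+\|\dot u^1(t)-\dot u^2(t)\|\le C_{\varrho,T}\,|\varphi^1-\varphi^2|_W,\qquad t\in I\cap[0,T].$$ -/

import Mathlib

open Set Filter Topology

noncomputable section

namespace DelayWave

/-! ### Positive operators with discrete spectrum -/

/-- A positive (self-adjoint, densely defined) operator with discrete spectrum in a real Hilbert
space `H`: there is an orthonormal basis `e_0, e_1, …` of `H` consisting of eigenvectors, with
eigenvalues `0 < μ_0 ≤ μ_1 ≤ …` tending to infinity. -/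
structure PosDiscreteOp (H : Type*) [NormedAddCommGroup H] [InnerProductSpace ℝ H]
    [CompleteSpace H] where
  /-- the operator, with its domain `D(A)` -/
  op : H →ₗ.[ℝ] H
  selfAdjoint : IsSelfAdjoint op
  basis : HilbertBasis ℕ ℝ H
  eig : ℕ → ℝ
  eig_pos : ∀ n, 0 < eig n
  eig_mono : Monotone eig
  eig_tendsto : Tendsto eig atTop atTop
  basis_mem : ∀ n, basis n ∈ op.domain
  op_basis : ∀ n, op ⟨basis n, basis_mem n⟩ = eig n • basis n

namespace PosDiscreteOp

variable {H : Type*} [NormedAddCommGroup H] [InnerProductSpace ℝ H] [CompleteSpace H]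
variable (A : PosDiscreteOp H)

/-- The subspace `D(A^{1/2}) = {u : ∑ μ_n |(u, e_n)|² < ∞}` of `H`. -/
def halfSubmodule : Submodule ℝ H where
  carrier := {u | Memℓp (fun n => √(A.eig n) * A.basis.repr u n) 2}
  zero_mem' := by
    have : (fun n => √(A.eig n) * A.basis.repr (0 : H) n) = 0 := by ext n; simp
    change Memℓp _ 2
    rw [this]; exact zero_memℓp
  add_mem' := by
    intro u v hu hv
    have : (fun n => √(A.eig n) * A.basis.repr (u + v) n) =
        (fun n => √(A.eig n) * A.basis.repr u n) + fun n => √(A.eig n) * A.basis.repr v n := by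
      ext n; simp [mul_add]
    change Memℓp _ 2
    rw [this]; exact Memℓp.add hu hv
  smul_mem' := by
    intro c u hu
    have : (fun n => √(A.eig n) * A.basis.repr (c • u) n) =
        c • fun n => √(A.eig n) * A.basis.repr u n := by
      ext n; simp [mul_left_comm]
    change Memℓp _ 2
    rw [this]; exact Memℓp.const_smul hu c

/-- `D(A^{1/2})` as a type of its own; it carries the norm `u ↦ ‖A^{1/2} u‖` defined below and not
the norm of `H`. -/
def DHalf : Type _ := A.halfSubmodule

instance : AddCommGroup A.DHalf := inferInstanceAs (AddCommGroup A.halfSubmodule)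
instance : Module ℝ A.DHalf := inferInstanceAs (Module ℝ A.halfSubmodule)

/-- The inclusion `D(A^{1/2}) ⊆ H`. -/
def incl : A.DHalf →ₗ[ℝ] H := A.halfSubmodule.subtype

/-- The operator `A^{1/2} : D(A^{1/2}) → H`, `A^{1/2} u = ∑ μ_n^{1/2} (u, e_n) e_n`. -/
def sqrtOp : A.DHalf →ₗ[ℝ] H where
  toFun u := A.basis.repr.symm ⟨fun n => √(A.eig n) * A.basis.repr (A.incl u) n, u.2⟩
  map_add' u v := by
    rw [← map_add]; congr 1; ext n; simp [mul_add]; rfl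
  map_smul' c u := by
    rw [RingHom.id_apply, ← map_smul]; congr 1; ext n; simp [mul_left_comm]

theorem repr_sqrtOp (u : A.DHalf) (n : ℕ) :
    A.basis.repr (A.sqrtOp u) n = √(A.eig n) * A.basis.repr (A.incl u) n := by
  simp [sqrtOp]

theorem sqrtOp_injective : Function.Injective A.sqrtOp := by
  rw [injective_iff_map_eq_zero]
  intro u hu
  apply Subtype.ext
  change A.incl u = 0
  apply A.basis.repr.injective
  ext n
  have h1 := A.repr_sqrtOp u n
  have h2 : √(A.eig n) ≠ 0 := (Real.sqrt_pos.2 (A.eig_pos n)).ne'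
  rw [hu] at h1
  simpa [h2] using h1

theorem sqrtOp_surjective : Function.Surjective A.sqrtOp := by
  intro w
  have key : ∀ n, √(A.eig n) * ((√(A.eig n))⁻¹ * A.basis.repr w n) = A.basis.repr w n := by
    intro n
    rw [mul_inv_cancel_left₀ (Real.sqrt_pos.2 (A.eig_pos n)).ne']
  have hmem : Memℓp (fun n => (√(A.eig n))⁻¹ * A.basis.repr w n) 2 := by
    refine Memℓp.mono' (g := fun n => (√(A.eig 0))⁻¹ • A.basis.repr w n)
      (Memℓp.const_smul (𝕜 := ℝ) (E := fun _ : ℕ => ℝ) (lp.memℓp (A.basis.repr w)) _) ?_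
    intro n
    simp only [smul_eq_mul, norm_mul]
    gcongr
    rw [Real.norm_of_nonneg (by positivity), Real.norm_of_nonneg (by positivity)]
    exact inv_anti₀ (Real.sqrt_pos.2 (A.eig_pos 0)) (Real.sqrt_le_sqrt (A.eig_mono n.zero_le))
  let f : lp (fun _ : ℕ => ℝ) 2 := ⟨_, hmem⟩
  have hu : A.basis.repr.symm f ∈ A.halfSubmodule := by
    change Memℓp (fun n => √(A.eig n) * A.basis.repr (A.basis.repr.symm f) n) 2
    have : (fun n => √(A.eig n) * A.basis.repr (A.basis.repr.symm f) n) =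
        fun n => A.basis.repr w n := by
      ext n; rw [LinearIsometryEquiv.apply_symm_apply]; exact key n
    rw [this]; exact lp.memℓp _
  refine ⟨⟨_, hu⟩, A.basis.repr.injective ?_⟩
  ext n
  refine (A.repr_sqrtOp _ n).trans ?_
  change √(A.eig n) * A.basis.repr (A.basis.repr.symm f) n = _
  rw [LinearIsometryEquiv.apply_symm_apply]; exact key n

/-- `D(A^{1/2})` is normed by `‖u‖ := ‖A^{1/2} u‖_H`. -/
instance : NormedAddCommGroup A.DHalf :=
  NormedAddCommGroup.induced A.DHalf H A.sqrtOp A.sqrtOp_injective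

instance : NormedSpace ℝ A.DHalf := NormedSpace.induced ℝ A.DHalf H A.sqrtOp

theorem norm_DHalf (u : A.DHalf) : ‖u‖ = ‖A.sqrtOp u‖ := rfl

instance : CompleteSpace A.DHalf := by
  have e : A.DHalf ≃ₗᵢ[ℝ] H :=
    ⟨LinearEquiv.ofBijective A.sqrtOp ⟨A.sqrtOp_injective, A.sqrtOp_surjective⟩, fun _ => rfl⟩
  exact e.toIsometryEquiv.completeSpace

/-- The space `Y = D(A^{1/2}) × H`. -/
abbrev Y : Type _ := A.DHalf × H

/-- The operator `𝒜(u, v) = (-v, A u + k v)` in `Y` with domain `D(𝒜) = D(A) × D(A^{1/2})`. -/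
def blockOp (k : ℝ) : A.Y →ₗ.[ℝ] A.Y where
  domain :=
    (A.op.domain.comap (A.incl ∘ₗ LinearMap.fst ℝ A.DHalf H)) ⊓
      (A.halfSubmodule.comap (LinearMap.snd ℝ A.DHalf H))
  toFun :=
    { toFun := fun U =>
        ((-(⟨U.1.2, U.2.2⟩ : A.halfSubmodule) : A.halfSubmodule),
          A.op ⟨A.incl U.1.1, U.2.1⟩ + k • U.1.2)
      map_add' := by
        intro U V
        refine Prod.ext (Subtype.ext ?_) ?_
        · change -(U.1.2 + V.1.2) = -U.1.2 + -V.1.2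
          exact neg_add _ _
        · change A.op ⟨A.incl (U.1.1 + V.1.1), _⟩ + k • (U.1.2 + V.1.2) =
            (A.op ⟨A.incl U.1.1, U.2.1⟩ + k • U.1.2) + (A.op ⟨A.incl V.1.1, V.2.1⟩ + k • V.1.2)
          have : A.op ⟨A.incl (U.1.1 + V.1.1), (U + V).2.1⟩ =
              A.op ⟨A.incl U.1.1, U.2.1⟩ + A.op ⟨A.incl V.1.1, V.2.1⟩ := by
            rw [← LinearPMap.map_add]; congr 1
          rw [this, smul_add]; abel
      map_smul' := by
        intro c U
        refine Prod.ext (Subtype.ext ?_) ?_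
        · change -(c • U.1.2) = c • -U.1.2
          exact (smul_neg c U.1.2).symm
        · change A.op ⟨A.incl (c • U.1.1), _⟩ + k • (c • U.1.2) =
            c • (A.op ⟨A.incl U.1.1, U.2.1⟩ + k • U.1.2)
          have : A.op ⟨A.incl (c • U.1.1), (c • U).2.1⟩ = c • A.op ⟨A.incl U.1.1, U.2.1⟩ := by
            rw [← LinearPMap.map_smul]; congr 1
          rw [this, smul_add, smul_comm] }

end PosDiscreteOp

/-! ### Strongly continuous semigroups -/

section Semigroup

variable {X : Type*} [NormedAddCommGroup X] [NormedSpace ℝ X]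

/-- `(S t)_{t ≥ 0}` is a `C₀`-semigroup of bounded operators in `X` (the values of `S` at negative
times play no role). -/
structure IsC0Semigroup (S : ℝ → X →L[ℝ] X) : Prop where
  zero : S 0 = ContinuousLinearMap.id ℝ X
  add : ∀ s t, 0 ≤ s → 0 ≤ t → S (s + t) = (S s).comp (S t)
  tendsto : ∀ x, Tendsto (fun t => S t x) (𝓝[>] 0) (𝓝 x)

/-- `B` (with its domain) is the infinitesimal generator of `(S t)_{t ≥ 0}`: one has `x ∈ D(B)` and
`B x = y` if and only if `(S t x - x) / t → y` as `t → 0+`. -/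
def IsGenerator (S : ℝ → X →L[ℝ] X) (B : X →ₗ.[ℝ] X) : Prop :=
  ∀ x y : X, (x, y) ∈ B.graph ↔ Tendsto (fun t : ℝ => t⁻¹ • (S t x - x)) (𝓝[>] 0) (𝓝 y)

end Semigroup

/-! ### The phase space, the hypotheses, mild solutions -/

section Delay

variable {H : Type*} [NormedAddCommGroup H] [InnerProductSpace ℝ H] [CompleteSpace H]
variable (A : PosDiscreteOp H) (h : ℝ)

/-- A function `[-h,0] → D(A^{1/2})` regarded as an `H`-valued function of a real variable, extended
by zero outside `[-h,0]`. -/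
def extendH (φ : Icc (-h) 0 → A.DHalf) : ℝ → H :=
  Function.extend Subtype.val (fun θ => A.incl (φ θ)) 0

/-- The phase space `W = C([-h,0]; D(A^{1/2})) ∩ C¹([-h,0]; H)`. -/
def W : Set (Icc (-h) 0 → A.DHalf) :=
  {φ | Continuous φ ∧ ContDiffOn ℝ 1 (extendH A h φ) (Icc (-h) 0)}

variable {A h}

/-- The derivative `φ̇(θ)`, in the sense of `H`, at `θ ∈ [-h,0]` (one-sided at the end points). -/
def dot (φ : W A h) (θ : Icc (-h) 0) : H := derivWithin (extendH A h φ.1) (Icc (-h) 0) θ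

/-- `|φ|_W = max ‖A^{1/2} φ(θ)‖ + max ‖φ̇(θ)‖`, the maxima being over `θ ∈ [-h,0]`. -/
def normW (φ : W A h) : ℝ := (⨆ θ, ‖φ.1 θ‖) + ⨆ θ, ‖dot φ θ‖

/-- The distance `|φ₁ - φ₂|_W`. -/
def distW (φ₁ φ₂ : W A h) : ℝ := (⨆ θ, ‖φ₁.1 θ - φ₂.1 θ‖) + ⨆ θ, ‖dot φ₁ θ - dot φ₂ θ‖

/-- Hypothesis on `F`: it is locally Lipschitz from `D(A^{1/2})` to `H`. -/
def HypF1 (F : A.DHalf → H) : Prop :=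
  ∀ R > 0, ∃ L : ℝ, ∀ u₁ u₂ : A.DHalf, ‖u₁‖ ≤ R → ‖u₂‖ ≤ R → ‖F u₁ - F u₂‖ ≤ L * ‖u₁ - u₂‖

/-- Hypothesis on the structure of `F`: `F = Π' + F*` where `Π = Π₀ + Π₁` is a `C¹`-functional
on `D(A^{1/2})` and `F*` is globally Lipschitz; `Π₀` is nonnegative and bounded on bounded sets and
`Π₁` is dominated. The first two fields say that `Π` is `C¹` and that its Fréchet derivative at `u`
is the functional `v ↦ (F(u) - F*(u), v)`. -/
structure HypF2 (F Fstar : A.DHalf → H) (Pi0 Pi1 : A.DHalf → ℝ) : Prop where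
  contDiff : ContDiff ℝ 1 (fun u => Pi0 u + Pi1 u)
  fderiv_eq : ∀ u v : A.DHalf,
    fderiv ℝ (fun w => Pi0 w + Pi1 w) u v = inner ℝ (F u - Fstar u) (A.incl v)
  lipschitz : ∃ c₀ : ℝ, ∀ u₁ u₂ : A.DHalf, ‖Fstar u₁ - Fstar u₂‖ ^ 2 ≤ c₀ * ‖u₁ - u₂‖ ^ 2
  nonneg : ∀ u, 0 ≤ Pi0 u
  bounded : ∀ R > 0, ∃ B : ℝ, ∀ u : A.DHalf, ‖u‖ ≤ R → Pi0 u ≤ B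
  dominated : ∀ η > 0, ∃ C > 0, ∀ u : A.DHalf, |Pi1 u| ≤ η * (‖u‖ ^ 2 + Pi0 u) + C

/-- Hypothesis on the delay term: it is locally Lipschitz on `W`. -/
def HypM1 (M : W A h → H) : Prop :=
  ∀ ρ > 0, ∃ C : ℝ, ∀ φ₁ φ₂ : W A h, normW φ₁ ≤ ρ → normW φ₂ ≤ ρ →
    ‖M φ₁ - M φ₂‖ ≤ C * distW φ₁ φ₂

/-- Hypothesis on the delay term: it has at most linear growth on `W`. -/
def HypM2 (M : W A h → H) : Prop :=
  ∃ M₀ M₁ : ℝ, 0 ≤ M₀ ∧ 0 ≤ M₁ ∧ ∀ φ : W A h, ‖M φ‖ ≤ M₀ + M₁ * normW φ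

/-- The velocity `u̇(t)`, in the sense of `H`, of a function `u` on the interval `J`. -/
def velocity (J : Set ℝ) (u : ℝ → A.DHalf) (t : ℝ) : H := derivWithin (fun s => A.incl (u s)) J t

variable (h) in
/-- The history `u_t(θ) = u(t + θ)`, `θ ∈ [-h,0]`. -/
def history (u : ℝ → A.DHalf) (t : ℝ) : Icc (-h) 0 → A.DHalf := fun θ => u (t + θ)

/-- The value `M(u_t)`. For a solution the history `u_t` belongs to `W` at all times considered; the
extension of `M` by zero outside `W` only makes the expression total. -/
def delayTerm (M : W A h → H) (u : ℝ → A.DHalf) (t : ℝ) : H :=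
  Function.extend Subtype.val M 0 (history h u t)

variable (h) in
/-- The intervals on which solutions live: `[-h,T]`, `[-h,T)` and `[-h,∞)`. -/
def IsTimeInterval (J : Set ℝ) : Prop := J.OrdConnected ∧ Icc (-h) 0 ⊆ J ∧ J ⊆ Ici (-h)

/-- Let `(S t)_{t ≥ 0}` be the semigroup `e^{-t𝒜}`. The function `u` is a mild solution of
`ü + k u̇ + A u + F(u) + M(u_t) = 0` with initial function `φ`, on the interval `J ∩ [0,∞)`:
`u ∈ C(J; D(A^{1/2})) ∩ C¹(J; H)`, `u = φ` on `[-h,0]`, and `U = (u, u̇)` satisfies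
`U(t) = e^{-t𝒜} U(0) + ∫_0^t e^{-(t-s)𝒜} (0, -F(u(s)) - M(u_s)) ds`.
The values of `u` outside `J` play no role. -/
structure IsMildSolution (S : ℝ → A.Y →L[ℝ] A.Y) (F : A.DHalf → H) (M : W A h → H)
    (J : Set ℝ) (φ : W A h) (u : ℝ → A.DHalf) : Prop where
  continuousOn : ContinuousOn u J
  contDiffOn : ContDiffOn ℝ 1 (fun t => A.incl (u t)) J
  initial : ∀ θ : Icc (-h) 0, u θ = φ.1 θ
  duhamel : ∀ t ∈ J, 0 ≤ t →
    ((u t, velocity J u t) : A.Y) = S t (u 0, velocity J u 0) +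
      ∫ s in (0 : ℝ)..t, S (t - s) (0, -F (u s) - delayTerm M u s)

/-- The energy `ℰ(u,v) = (‖v‖² + ‖A^{1/2} u‖²)/2 + Π₀(u) + Π₁(u)`. -/
def energy (Pi0 Pi1 : A.DHalf → ℝ) (u : A.DHalf) (v : H) : ℝ :=
  1 / 2 * (‖v‖ ^ 2 + ‖A.sqrtOp u‖ ^ 2) + Pi0 u + Pi1 u

end Delay

end DelayWave

end

open Set Filter Topology

noncomputable section

namespace DelayWave

/-! ### A single mode -/

/-! In the eigenbasis of `A` the linear equation decouples. With `ω = √μ_n`, the pair `x = ω (u,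
e_n)`, `y = (u̇, e_n)` satisfies `x' = ω y`, `y' = -ω x - k y`. The terms in `ω` cancel in the
derivative of `x² + y²`, so each flow is bounded by a constant independent of `n`, and the flows
assemble into a strongly continuous group on `Y` (`waveGroup`). Self-adjointness makes `D(A)` as
large as the coefficients allow, which identifies the generator with `-𝒜`. Under a continuous
forcing every mode is a classical solution, so the relation between position and velocity and the
energy identity are checked mode by mode and then summed (`incl_forcedFlow`, `energy_forcedFlow`).

On a compact interval a mild solution is a linear solution with the continuous forcing `-F(u) -
M(u_t)`. The energy equality then needs `d/dt Π(u) = (F(u) - F*(u), u̇)`, although `u` is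
differentiable only in `H`. This holds because `Π'` is represented by a continuous `H`-valued map,
so the first-order remainder of `Π` is small relative to the `H`-norm of the increment
(`HypF2.isLittleO`).

The growth conditions make the energy coercive up to constants, while the remaining forces grow
linearly in the past of the solution. A Gronwall argument with an exponential weight
(`le_of_forall_exp_bound`) bounds solutions on finite time intervals, uniformly for bounded data.
Inside such a bound `F` and `M` are Lipschitz, and the same argument applied to differences gives
Lipschitz dependence and uniqueness.

For existence, the total force `φ ↦ F(φ(0)) + M(φ)` is cut off to a globally Lipschitz one and the
truncated problem is solved by a contraction. The a priori bound, applied up to the first time the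
history could reach the cutoff, shows that it never does. Uniqueness glues the solutions on `[-h,
n+1]` into a global one. -/

/-- The generator of the damped oscillator `x' = ω y`, `y' = -ω x - k y`. -/
def modeGen (ω k : ℝ) : (ℝ × ℝ) →L[ℝ] (ℝ × ℝ) :=
  (ω • ContinuousLinearMap.snd ℝ ℝ ℝ).prod
    (-(ω • ContinuousLinearMap.fst ℝ ℝ ℝ) - k • ContinuousLinearMap.snd ℝ ℝ ℝ)

@[simp] theorem modeGen_apply (ω k : ℝ) (x : ℝ × ℝ) :
    modeGen ω k x = (ω * x.2, -(ω * x.1) - k * x.2) := rfl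

/-- The flow of the damped oscillator. -/
def modeExp (ω k t : ℝ) : (ℝ × ℝ) →L[ℝ] (ℝ × ℝ) := NormedSpace.exp (t • modeGen ω k)

@[simp] theorem modeExp_zero (ω k : ℝ) : modeExp ω k 0 = ContinuousLinearMap.id ℝ _ := by
  simp only [modeExp, zero_smul, NormedSpace.exp_zero]; rfl

theorem modeExp_add (ω k s t : ℝ) :
    modeExp ω k (s + t) = (modeExp ω k s).comp (modeExp ω k t) := by
  let _ : NormedAlgebra ℚ ((ℝ × ℝ) →L[ℝ] (ℝ × ℝ)) := NormedAlgebra.restrictScalars ℚ ℝ _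
  simp only [modeExp, add_smul]
  exact NormedSpace.exp_add_of_commute (((Commute.refl (modeGen ω k)).smul_left s).smul_right t)

theorem hasDerivAt_modeExp (ω k t : ℝ) :
    HasDerivAt (modeExp ω k) ((modeGen ω k).comp (modeExp ω k t)) t :=
  hasDerivAt_exp_smul_const' (𝕂 := ℝ) (modeGen ω k) t

theorem hasDerivAt_modeExp' (ω k t : ℝ) :
    HasDerivAt (modeExp ω k) ((modeExp ω k t).comp (modeGen ω k)) t :=
  hasDerivAt_exp_smul_const (𝕂 := ℝ) (modeGen ω k) t

theorem hasDerivAt_modeExp_apply (ω k t : ℝ) (x : ℝ × ℝ) :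
    HasDerivAt (fun t => modeExp ω k t x) (modeGen ω k (modeExp ω k t x)) t := by
  simpa using (hasDerivAt_modeExp ω k t).clm_apply (hasDerivAt_const t x)

theorem hasDerivAt_modeExp_apply' (ω k t : ℝ) (x : ℝ × ℝ) :
    HasDerivAt (fun t => modeExp ω k t x) (modeExp ω k t (modeGen ω k x)) t := by
  simpa using (hasDerivAt_modeExp' ω k t).clm_apply (hasDerivAt_const t x)

theorem continuous_modeExp_apply (ω k : ℝ) (x : ℝ × ℝ) : Continuous fun t => modeExp ω k t x :=
  continuous_iff_continuousAt.2 fun t => (hasDerivAt_modeExp_apply ω k t x).continuousAt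

/-- The rotation terms cancel, so the derivative of `x² + y²` is `-2ky²`, of absolute value at most
`2|k|(x² + y²)`. An exponential factor makes the product monotone, decreasing for positive times and
increasing for negative ones. The bound does not involve `ω`, which is what allows infinitely many
modes to be combined. -/
theorem modeExp_energy_le (ω k t : ℝ) (x : ℝ × ℝ) :
    (modeExp ω k t x).1 ^ 2 + (modeExp ω k t x).2 ^ 2 ≤
      Real.exp (2 * |k| * |t|) * (x.1 ^ 2 + x.2 ^ 2) := by
  set q : ℝ → ℝ := fun t => (modeExp ω k t x).1 ^ 2 + (modeExp ω k t x).2 ^ 2 with hq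
  have hd : ∀ t, HasDerivAt q (-(2 * k * (modeExp ω k t x).2 ^ 2)) t := by
    intro t
    have h := hasDerivAt_modeExp_apply ω k t x
    have h1 := (hasFDerivAt_fst.comp_hasDerivAt t h).fun_pow 2
    have h2 := (hasFDerivAt_snd.comp_hasDerivAt t h).fun_pow 2
    refine (h1.add h2).congr_deriv ?_
    simp
    ring
  have hk := neg_abs_le k
  have hk' := le_abs_self k
  rcases le_total 0 t with ht | ht
  · have hanti : Antitone fun s => Real.exp (-(2 * |k|) * s) * q s := by
      refine antitone_of_hasDerivAt_nonpos (f' := fun s => Real.exp (-(2 * |k|) * s) *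
        (-(2 * |k|) * q s + -(2 * k * (modeExp ω k s x).2 ^ 2))) (fun s => ?_) fun s => ?_
      · refine ((((hasDerivAt_id s).const_mul (-(2 * |k|))).exp).mul (hd s)).congr_deriv ?_
        simp; ring
      · refine mul_nonpos_of_nonneg_of_nonpos (Real.exp_pos _).le ?_
        simp only [hq]
        nlinarith [mul_nonneg (abs_nonneg k) (sq_nonneg (modeExp ω k s x).1),
          mul_nonneg (by linarith : 0 ≤ |k| + k) (sq_nonneg (modeExp ω k s x).2)]
    have := hanti ht
    simp only [mul_zero, Real.exp_zero, one_mul, hq, modeExp_zero,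
      ContinuousLinearMap.id_apply] at this
    rw [abs_of_nonneg ht]
    calc _ = Real.exp (2 * |k| * t) * (Real.exp (-(2 * |k|) * t) *
          ((modeExp ω k t x).1 ^ 2 + (modeExp ω k t x).2 ^ 2)) := by
            rw [← mul_assoc, ← Real.exp_add]; simp
      _ ≤ _ := by gcongr
  · have hmono : Monotone fun s => Real.exp ((2 * |k|) * s) * q s := by
      refine monotone_of_hasDerivAt_nonneg (f' := fun s => Real.exp ((2 * |k|) * s) *
        ((2 * |k|) * q s + -(2 * k * (modeExp ω k s x).2 ^ 2))) (fun s => ?_) fun s => ?_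
      · refine ((((hasDerivAt_id s).const_mul ((2 * |k|))).exp).mul (hd s)).congr_deriv ?_
        simp; ring
      · refine mul_nonneg (Real.exp_pos _).le ?_
        simp only [hq]
        nlinarith [mul_nonneg (abs_nonneg k) (sq_nonneg (modeExp ω k s x).1),
          mul_nonneg (by linarith : 0 ≤ |k| - k) (sq_nonneg (modeExp ω k s x).2)]
    have := hmono ht
    simp only [mul_zero, Real.exp_zero, one_mul, hq, modeExp_zero,
      ContinuousLinearMap.id_apply] at this
    rw [abs_of_nonpos ht]
    calc _ = Real.exp (2 * |k| * -t) * (Real.exp (2 * |k| * t) *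
          ((modeExp ω k t x).1 ^ 2 + (modeExp ω k t x).2 ^ 2)) := by
            rw [← mul_assoc, ← Real.exp_add]; simp
      _ ≤ _ := by gcongr

theorem abs_modeExp_fst_le (ω k t : ℝ) {x : ℝ × ℝ} (hx : x.1 ^ 2 + x.2 ^ 2 = 1) :
    |(modeExp ω k t x).1| ≤ Real.exp (|k| * |t|) := by
  refine abs_le_of_sq_le_sq ?_ (Real.exp_pos _).le
  have := modeExp_energy_le ω k t x
  rw [← Real.exp_nat_mul]
  rw [hx, mul_one] at this
  push_cast
  rw [← mul_assoc]
  nlinarith [sq_nonneg (modeExp ω k t x).2]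

theorem abs_modeExp_snd_le (ω k t : ℝ) {x : ℝ × ℝ} (hx : x.1 ^ 2 + x.2 ^ 2 = 1) :
    |(modeExp ω k t x).2| ≤ Real.exp (|k| * |t|) := by
  refine abs_le_of_sq_le_sq ?_ (Real.exp_pos _).le
  have := modeExp_energy_le ω k t x
  rw [← Real.exp_nat_mul]
  rw [hx, mul_one] at this
  push_cast
  rw [← mul_assoc]
  nlinarith [sq_nonneg (modeExp ω k t x).1]

theorem modeExp_apply_eq (ω k t : ℝ) (x : ℝ × ℝ) :
    modeExp ω k t x = x.1 • modeExp ω k t (1, 0) + x.2 • modeExp ω k t (0, 1) := by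
  rw [← map_smul, ← map_smul, ← map_add]; simp

/-! ### Diagonal operators -/

section Diag

variable {H : Type*} [NormedAddCommGroup H] [InnerProductSpace ℝ H]

theorem hasSum_repr_mul_repr (b : HilbertBasis ℕ ℝ H) (x y : H) :
    HasSum (fun n => b.repr x n * b.repr y n) (inner ℝ x y) := by
  have := b.hasSum_inner_mul_inner x y
  simpa only [b.repr_apply_apply, real_inner_comm (b _) x] using this

theorem hasSum_repr_sq (b : HilbertBasis ℕ ℝ H) (x : H) :
    HasSum (fun n => b.repr x n ^ 2) (‖x‖ ^ 2) := by
  simpa only [real_inner_self_eq_norm_sq, ← pow_two] using hasSum_repr_mul_repr b x x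

theorem memℓp_mul_repr (b : HilbertBasis ℕ ℝ H) {m : ℕ → ℝ} {C : ℝ} (hm : ∀ n, |m n| ≤ C) (x : H) :
    Memℓp (fun n => m n * b.repr x n) 2 := by
  refine Memℓp.mono' (g := fun n => C • b.repr x n)
    (Memℓp.const_smul (𝕜 := ℝ) (E := fun _ : ℕ => ℝ) (lp.memℓp (b.repr x)) _) fun n => ?_
  have hC : 0 ≤ C := (abs_nonneg _).trans (hm 0)
  simp only [smul_eq_mul, norm_mul, Real.norm_eq_abs]
  rw [abs_of_nonneg hC]
  gcongr
  exact hm n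

/-- The linear map acting on the `n`-th coordinate as multiplication by `m n`. -/
def diagLin (b : HilbertBasis ℕ ℝ H) (m : ℕ → ℝ) (C : ℝ) (hm : ∀ n, |m n| ≤ C) : H →ₗ[ℝ] H where
  toFun x := b.repr.symm ⟨fun n => m n * b.repr x n, memℓp_mul_repr b hm x⟩
  map_add' x y := by
    rw [← map_add]; congr 1; ext n; simp [mul_add]; rfl
  map_smul' c x := by
    rw [RingHom.id_apply, ← map_smul]; congr 1; ext n; simp [mul_left_comm]

theorem repr_diagLin (b : HilbertBasis ℕ ℝ H) {m : ℕ → ℝ} {C : ℝ} (hm : ∀ n, |m n| ≤ C) (x : H)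
    (n : ℕ) : b.repr (diagLin b m C hm x) n = m n * b.repr x n := by
  simp [diagLin]

theorem norm_diagLin_apply_le (b : HilbertBasis ℕ ℝ H) {m : ℕ → ℝ} {C : ℝ} (hm : ∀ n, |m n| ≤ C)
    (x : H) : ‖diagLin b m C hm x‖ ≤ C * ‖x‖ := by
  have hC : 0 ≤ C := (abs_nonneg _).trans (hm 0)
  refine (sq_le_sq₀ (norm_nonneg _) (by positivity)).1 ?_
  rw [mul_pow]
  refine hasSum_le (fun n => ?_) (hasSum_repr_sq b _) ((hasSum_repr_sq b x).mul_left (C ^ 2))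
  rw [repr_diagLin, mul_pow]
  exact mul_le_mul_of_nonneg_right (sq_le_sq' (abs_le.1 (hm n)).1 (abs_le.1 (hm n)).2)
    (sq_nonneg _)

/-- The bounded operator acting on the `n`-th coordinate as multiplication by `m n`. -/
def diagOp (b : HilbertBasis ℕ ℝ H) (m : ℕ → ℝ) (C : ℝ) (hm : ∀ n, |m n| ≤ C) : H →L[ℝ] H :=
  (diagLin b m C hm).mkContinuous C (norm_diagLin_apply_le b hm)

theorem repr_diagOp (b : HilbertBasis ℕ ℝ H) {m : ℕ → ℝ} {C : ℝ} (hm : ∀ n, |m n| ≤ C) (x : H)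
    (n : ℕ) : b.repr (diagOp b m C hm x) n = m n * b.repr x n :=
  repr_diagLin b hm x n

theorem norm_diagOp_apply_le (b : HilbertBasis ℕ ℝ H) {m : ℕ → ℝ} {C : ℝ} (hm : ∀ n, |m n| ≤ C)
    (x : H) : ‖diagOp b m C hm x‖ ≤ C * ‖x‖ :=
  norm_diagLin_apply_le b hm x

/-- Diagonal operators depend strongly continuously on their entries. -/
theorem tendsto_diagOp (b : HilbertBasis ℕ ℝ H) {m : ℝ → ℕ → ℝ} {C : ℝ → ℝ}
    (hm : ∀ t n, |m t n| ≤ C t) (hmc : ∀ n, Continuous fun t => m t n) (hC : Continuous C) (x : H)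
    (t₀ : ℝ) :
    Tendsto (fun t => diagOp b (m t) (C t) (hm t) x) (𝓝 t₀)
      (𝓝 (diagOp b (m t₀) (C t₀) (hm t₀) x)) := by
  have key : ∀ t, ‖diagOp b (m t) (C t) (hm t) x - diagOp b (m t₀) (C t₀) (hm t₀) x‖ ^ 2 =
      ∑' n, ((m t n - m t₀ n) * b.repr x n) ^ 2 := by
    intro t
    rw [← (hasSum_repr_sq b _).tsum_eq]
    congr 1; ext n
    rw [map_sub, lp.coeFn_sub, Pi.sub_apply, repr_diagOp, repr_diagOp, sub_mul]
  have hlim : Tendsto (fun t => ∑' n, ((m t n - m t₀ n) * b.repr x n) ^ 2) (𝓝 t₀) (𝓝 0) := by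
    have h0 : (0 : ℝ) = ∑' n, ((m t₀ n - m t₀ n) * b.repr x n) ^ 2 := by simp
    rw [h0]
    -- Near `t₀` one has `C t < C t₀ + 1`, so both entries are bounded and the square-summable
    -- coefficients of `x` dominate the series.
    refine tendsto_tsum_of_dominated_convergence
      (bound := fun n => (C t₀ + 1 + C t₀) ^ 2 * b.repr x n ^ 2)
      ((hasSum_repr_sq b x).summable.mul_left _) (fun n => ?_) ?_
    · exact ((((hmc n).sub continuous_const).mul continuous_const).pow 2).tendsto t₀
    · filter_upwards [hC.tendsto t₀ |>.eventually (gt_mem_nhds (lt_add_one (C t₀)))] with t ht n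
      rw [Real.norm_eq_abs, abs_of_nonneg (sq_nonneg _), mul_pow]
      have h1 : |m t n - m t₀ n| ≤ C t₀ + 1 + C t₀ :=
        (abs_sub _ _).trans (add_le_add ((hm t n).trans ht.le) (hm t₀ n))
      have h2 := sq_le_sq' (abs_le.1 h1).1 (abs_le.1 h1).2
      gcongr
  refine tendsto_iff_norm_sub_tendsto_zero.2 ?_
  have := (hlim.congr fun t => (key t).symm).sqrt
  simpa using this

end Diag

/-! ### The wave group -/

section Wave

variable {H : Type*} [NormedAddCommGroup H] [InnerProductSpace ℝ H] [CompleteSpace H]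
variable (A : PosDiscreteOp H)

/-- `A^{1/2}` as an isometric isomorphism of `D(A^{1/2})` onto `H`. -/
def sqrtEquiv : A.DHalf ≃ₗᵢ[ℝ] H :=
  ⟨LinearEquiv.ofBijective A.sqrtOp ⟨A.sqrtOp_injective, A.sqrtOp_surjective⟩, fun _ => rfl⟩

theorem incl_injective : Function.Injective A.incl := Subtype.val_injective

/-- The `n`-th coordinate of an element of `H`. -/
def coordL (n : ℕ) : H →L[ℝ] ℝ := innerSL ℝ (A.basis n)

@[simp] theorem coordL_apply (n : ℕ) (x : H) : coordL A n x = A.basis.repr x n :=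
  (A.basis.repr_apply_apply x n).symm

/-- The `n`-th mode `(μ_n^{1/2} (u, e_n), (v, e_n))` of `(u, v)`. -/
def mode (n : ℕ) : A.Y →L[ℝ] ℝ × ℝ :=
  ((coordL A n).comp ((sqrtEquiv A).toContinuousLinearEquiv.toContinuousLinearMap)).prodMap
    (coordL A n)

theorem mode_apply (n : ℕ) (x : A.Y) :
    mode A n x = (A.basis.repr (A.sqrtOp x.1) n, A.basis.repr x.2 n) := by
  refine Prod.ext ?_ ?_
  · exact coordL_apply A n (A.sqrtOp x.1)
  · exact coordL_apply A n x.2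

/-- The modes separate points of `Y`; identities in `Y` are thereby reduced to identities between
oscillators. -/
theorem mode_ext {x y : A.Y} (h : ∀ n, mode A n x = mode A n y) : x = y := by
  simp only [mode_apply, Prod.mk.injEq] at h
  refine Prod.ext (A.sqrtOp_injective (A.basis.repr.injective ?_)) (A.basis.repr.injective ?_)
  · ext n; exact (h n).1
  · ext n; exact (h n).2

theorem hasSum_mode_sq (x : A.Y) :
    HasSum (fun n => (mode A n x).1 ^ 2 + (mode A n x).2 ^ 2) (‖x.1‖ ^ 2 + ‖x.2‖ ^ 2) := by
  simp only [mode_apply]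
  exact (hasSum_repr_sq A.basis (A.sqrtOp x.1)).add (hasSum_repr_sq A.basis x.2)

variable (k : ℝ)

/-- The frequency of the `n`-th mode. -/
abbrev freq (n : ℕ) : ℝ := √(A.eig n)

/-- Diagonal operator with entries the first component of the oscillators started at `y`. -/
def blockFst (y : ℝ × ℝ) (hy : y.1 ^ 2 + y.2 ^ 2 = 1) (t : ℝ) : H →L[ℝ] H :=
  diagOp A.basis (fun n => (modeExp (freq A n) k t y).1) (Real.exp (|k| * |t|))
    fun n => abs_modeExp_fst_le (freq A n) k t hy

/-- Diagonal operator with entries the second component of the oscillators started at `y`. -/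
def blockSnd (y : ℝ × ℝ) (hy : y.1 ^ 2 + y.2 ^ 2 = 1) (t : ℝ) : H →L[ℝ] H :=
  diagOp A.basis (fun n => (modeExp (freq A n) k t y).2) (Real.exp (|k| * |t|))
    fun n => abs_modeExp_snd_le (freq A n) k t hy

theorem repr_blockFst (y : ℝ × ℝ) (hy : y.1 ^ 2 + y.2 ^ 2 = 1) (t : ℝ) (x : H) (n : ℕ) :
    A.basis.repr (blockFst A k y hy t x) n = (modeExp (freq A n) k t y).1 * A.basis.repr x n :=
  repr_diagOp _ _ _ _

theorem repr_blockSnd (y : ℝ × ℝ) (hy : y.1 ^ 2 + y.2 ^ 2 = 1) (t : ℝ) (x : H) (n : ℕ) :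
    A.basis.repr (blockSnd A k y hy t x) n = (modeExp (freq A n) k t y).2 * A.basis.repr x n :=
  repr_diagOp _ _ _ _

theorem norm_blockFst_le (y : ℝ × ℝ) (hy : y.1 ^ 2 + y.2 ^ 2 = 1) (t : ℝ) (x : H) :
    ‖blockFst A k y hy t x‖ ≤ Real.exp (|k| * |t|) * ‖x‖ := norm_diagOp_apply_le _ _ _

theorem norm_blockSnd_le (y : ℝ × ℝ) (hy : y.1 ^ 2 + y.2 ^ 2 = 1) (t : ℝ) (x : H) :
    ‖blockSnd A k y hy t x‖ ≤ Real.exp (|k| * |t|) * ‖x‖ := norm_diagOp_apply_le _ _ _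

theorem continuous_blockFst (y : ℝ × ℝ) (hy : y.1 ^ 2 + y.2 ^ 2 = 1) (x : H) :
    Continuous fun t => blockFst A k y hy t x :=
  continuous_iff_continuousAt.2 fun t => tendsto_diagOp A.basis (C := fun t => Real.exp (|k| * |t|))
    (fun t n => abs_modeExp_fst_le (freq A n) k t hy)
    (fun n => (continuous_modeExp_apply (freq A n) k y).fst) (by fun_prop) x t

theorem continuous_blockSnd (y : ℝ × ℝ) (hy : y.1 ^ 2 + y.2 ^ 2 = 1) (x : H) :
    Continuous fun t => blockSnd A k y hy t x :=
  continuous_iff_continuousAt.2 fun t => tendsto_diagOp A.basis (C := fun t => Real.exp (|k| * |t|))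
    (fun t n => abs_modeExp_snd_le (freq A n) k t hy)
    (fun n => (continuous_modeExp_apply (freq A n) k y).snd) (by fun_prop) x t

/-- The group `e^{-t𝒜}`, `t ∈ ℝ`, acting in the `n`-th mode as the flow of a damped oscillator. -/
def waveGroup (t : ℝ) : A.Y →L[ℝ] A.Y :=
  ((sqrtEquiv A).symm.toContinuousLinearEquiv.toContinuousLinearMap.comp
    ((blockFst A k (1, 0) (by norm_num) t).comp
        ((sqrtEquiv A).toContinuousLinearEquiv.toContinuousLinearMap.comp
          (ContinuousLinearMap.fst ℝ A.DHalf H)) +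
      (blockFst A k (0, 1) (by norm_num) t).comp (ContinuousLinearMap.snd ℝ A.DHalf H))).prod
    ((blockSnd A k (1, 0) (by norm_num) t).comp
        ((sqrtEquiv A).toContinuousLinearEquiv.toContinuousLinearMap.comp
          (ContinuousLinearMap.fst ℝ A.DHalf H)) +
      (blockSnd A k (0, 1) (by norm_num) t).comp (ContinuousLinearMap.snd ℝ A.DHalf H))

theorem waveGroup_apply (t : ℝ) (x : A.Y) :
    waveGroup A k t x =
      ((sqrtEquiv A).symm (blockFst A k (1, 0) (by norm_num) t (A.sqrtOp x.1) +
        blockFst A k (0, 1) (by norm_num) t x.2),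
      blockSnd A k (1, 0) (by norm_num) t (A.sqrtOp x.1) +
        blockSnd A k (0, 1) (by norm_num) t x.2) := rfl

theorem sqrtOp_symm (x : H) : A.sqrtOp ((sqrtEquiv A).symm x) = x :=
  (sqrtEquiv A).apply_symm_apply x

/-- The four diagonal blocks are the entries of the matrices `modeExp`, so the group is conjugated
by `mode` to the oscillator flow. Later computations use this rule and not the block formula. -/
theorem mode_waveGroup (n : ℕ) (t : ℝ) (x : A.Y) :
    mode A n (waveGroup A k t x) = modeExp (freq A n) k t (mode A n x) := by
  rw [modeExp_apply_eq, mode_apply, mode_apply, waveGroup_apply, sqrtOp_symm, map_add, map_add,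
    lp.coeFn_add, lp.coeFn_add, Pi.add_apply, Pi.add_apply, repr_blockFst, repr_blockFst,
    repr_blockSnd, repr_blockSnd]
  refine Prod.ext ?_ ?_ <;> simp [mul_comm]

/-- The factor 2 appears because each row has two blocks and `Y` carries the maximum norm. -/
theorem norm_waveGroup_apply_le (t : ℝ) (x : A.Y) :
    ‖waveGroup A k t x‖ ≤ 2 * Real.exp (|k| * |t|) * ‖x‖ := by
  have h1 : ‖A.sqrtOp x.1‖ ≤ ‖x‖ := norm_fst_le x
  have h2 : ‖x.2‖ ≤ ‖x‖ := norm_snd_le x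
  have he := Real.exp_pos (|k| * |t|)
  rw [waveGroup_apply]
  refine norm_prod_le_iff.2 ⟨?_, ?_⟩
  · rw [LinearIsometryEquiv.norm_map]
    refine (norm_add_le _ _).trans ((add_le_add (norm_blockFst_le _ _ _ _ _ _)
      (norm_blockFst_le _ _ _ _ _ _)).trans ?_)
    nlinarith [mul_le_mul_of_nonneg_left h1 he.le, mul_le_mul_of_nonneg_left h2 he.le]
  · refine (norm_add_le _ _).trans ((add_le_add (norm_blockSnd_le _ _ _ _ _ _)
      (norm_blockSnd_le _ _ _ _ _ _)).trans ?_)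
    nlinarith [mul_le_mul_of_nonneg_left h1 he.le, mul_le_mul_of_nonneg_left h2 he.le]

theorem waveGroup_zero : waveGroup A k 0 = ContinuousLinearMap.id ℝ A.Y := by
  refine ContinuousLinearMap.ext fun x => ?_
  exact mode_ext A fun n => by simp [mode_waveGroup]

theorem waveGroup_add (s t : ℝ) :
    waveGroup A k (s + t) = (waveGroup A k s).comp (waveGroup A k t) := by
  refine ContinuousLinearMap.ext fun x => ?_
  exact mode_ext A fun n => by simp [mode_waveGroup, modeExp_add]

theorem waveGroup_add_apply (s t : ℝ) (x : A.Y) :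
    waveGroup A k (s + t) x = waveGroup A k s (waveGroup A k t x) := by
  rw [waveGroup_add]; rfl

theorem continuous_waveGroup_apply (x : A.Y) : Continuous fun t => waveGroup A k t x := by
  simp only [waveGroup_apply]
  exact Continuous.prodMk ((sqrtEquiv A).symm.continuous.comp
    ((continuous_blockFst A k _ _ _).add (continuous_blockFst A k _ _ _)))
    ((continuous_blockSnd A k _ _ _).add (continuous_blockSnd A k _ _ _))

/-- Strong continuity and a locally uniform norm bound give joint continuity: near `s₀`, the vector
`g s` is split into the fixed `g s₀` and the small difference `g s - g s₀`. -/
theorem continuous_waveGroup {X : Type*} [TopologicalSpace X] {r : X → ℝ} {g : X → A.Y}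
    (hr : Continuous r) (hg : Continuous g) : Continuous fun s => waveGroup A k (r s) (g s) := by
  rw [continuous_iff_continuousAt]
  intro s₀
  have h1 : Tendsto (fun s => waveGroup A k (r s) (g s₀)) (𝓝 s₀)
      (𝓝 (waveGroup A k (r s₀) (g s₀))) :=
    ((continuous_waveGroup_apply A k (g s₀)).comp hr).tendsto s₀
  have h2 : Tendsto (fun s => waveGroup A k (r s) (g s - g s₀)) (𝓝 s₀) (𝓝 0) := by
    have h3 : Tendsto (fun s => 2 * Real.exp (|k| * |r s|) * ‖g s - g s₀‖) (𝓝 s₀) (𝓝 0) := by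
      have : Continuous fun s => 2 * Real.exp (|k| * |r s|) * ‖g s - g s₀‖ := by fun_prop
      simpa using this.tendsto s₀
    exact squeeze_zero_norm (fun s => norm_waveGroup_apply_le A k _ _) h3
  have h4 := h2.add h1
  rw [zero_add] at h4
  refine h4.congr fun s => ?_
  rw [← map_add, sub_add_cancel]

theorem isC0Semigroup_waveGroup : IsC0Semigroup (waveGroup A k) where
  zero := waveGroup_zero A k
  add s t _ _ := waveGroup_add A k s t
  tendsto x := by
    have := (continuous_waveGroup_apply A k x).tendsto 0
    simp only [waveGroup_zero, ContinuousLinearMap.id_apply] at this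
    exact this.mono_left nhdsWithin_le_nhds

end Wave

/-! ### The generator of the wave group -/

section Generator

variable {H : Type*} [NormedAddCommGroup H] [InnerProductSpace ℝ H] [CompleteSpace H]
variable (A : PosDiscreteOp H) (k : ℝ)

theorem op_isFormalAdjoint : A.op.IsFormalAdjoint A.op := by
  have h := A.op.adjoint_isFormalAdjoint A.selfAdjoint.dense_domain
  rwa [LinearPMap.isSelfAdjoint_def.1 A.selfAdjoint] at h

theorem repr_op (w : A.op.domain) (n : ℕ) :
    A.basis.repr (A.op w) n = A.eig n * A.basis.repr (w : H) n := by
  have h := op_isFormalAdjoint A ⟨A.basis n, A.basis_mem n⟩ w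
  rw [A.op_basis, real_inner_smul_left] at h
  rw [A.basis.repr_apply_apply, A.basis.repr_apply_apply, h]

/-- Parseval turns the relation between coefficients into `(z, x) = (w, A x)` for all `x` in the
domain, which places `w` in the domain of the adjoint. Self-adjointness puts it in `D(A)`. -/
theorem mem_domain_of_repr {w z : H} (h : ∀ n, A.basis.repr z n = A.eig n * A.basis.repr w n) :
    ∃ hw : w ∈ A.op.domain, A.op ⟨w, hw⟩ = z := by
  have key : ∀ x : A.op.domain, inner ℝ z (x : H) = inner ℝ w (A.op x) := by
    intro x
    have h1 := hasSum_repr_mul_repr A.basis z x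
    have h2 := hasSum_repr_mul_repr A.basis w (A.op x)
    simp only [h, repr_op] at h1 h2
    refine h1.unique ?_
    convert h2 using 2
    ring
  have : ∃ hw : w ∈ A.op.adjoint.domain, A.op.adjoint ⟨w, hw⟩ = z :=
    ⟨LinearPMap.mem_adjoint_domain_of_exists _ ⟨z, key⟩,
      LinearPMap.adjoint_apply_eq A.selfAdjoint.dense_domain _ key⟩
  rwa [LinearPMap.isSelfAdjoint_def.1 A.selfAdjoint] at this

theorem freq_pos (n : ℕ) : 0 < freq A n := Real.sqrt_pos.2 (A.eig_pos n)

theorem freq_mul_self (n : ℕ) : freq A n * freq A n = A.eig n :=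
  Real.mul_self_sqrt (A.eig_pos n).le

/-- The first coordinates of the mode equations say `y.1 = x.2` in `H`, hence `x.2 ∈ D(A^{1/2})`.
The second coordinates give the coefficients of `A x.1`, hence `x.1 ∈ D(A)`. The domain conditions
are thus contained in the mode equations. -/
theorem mem_graph_neg_blockOp_iff (x y : A.Y) :
    (x, y) ∈ (-(A.blockOp k)).graph ↔ ∀ n, mode A n y = modeGen (freq A n) k (mode A n x) := by
  rw [LinearPMap.mem_graph_iff]
  constructor
  · rintro ⟨z, rfl, hz⟩ n
    simp only at hz
    rw [LinearPMap.neg_apply] at hz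
    have h1 : A.incl y.1 = (z : A.Y).2 := by rw [← hz]; exact neg_neg _
    have h2 : y.2 = -(A.op ⟨A.incl (z : A.Y).1, z.2.1⟩ + k • (z : A.Y).2) := by rw [← hz]; rfl
    rw [mode_apply, mode_apply, modeGen_apply, A.repr_sqrtOp, A.repr_sqrtOp, h1, h2]
    refine Prod.ext rfl ?_
    have h3 := repr_op A ⟨A.incl (z : A.Y).1, z.2.1⟩ n
    simp only [map_neg, map_add, map_smul, lp.coeFn_neg, lp.coeFn_add, lp.coeFn_smul,
      Pi.neg_apply, Pi.add_apply, Pi.smul_apply, smul_eq_mul, h3]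
    linear_combination A.basis.repr (A.incl (z : A.Y).1) n * freq_mul_self A n
  · intro h
    simp only [mode_apply, modeGen_apply, A.repr_sqrtOp, Prod.mk.injEq] at h
    have h1 : A.incl y.1 = x.2 := by
      refine A.basis.repr.injective ?_
      ext n
      exact mul_left_cancel₀ (freq_pos A n).ne' (h n).1
    obtain ⟨hw, hw'⟩ := mem_domain_of_repr A (w := A.incl x.1) (z := -(y.2 + k • x.2)) fun n => by
      simp only [map_neg, map_add, map_smul, lp.coeFn_neg, lp.coeFn_add, lp.coeFn_smul,
        Pi.neg_apply, Pi.add_apply, Pi.smul_apply, smul_eq_mul, (h n).2]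
      linear_combination A.basis.repr (A.incl x.1) n * freq_mul_self A n
    have hx2 : x.2 ∈ A.halfSubmodule := h1 ▸ y.1.2
    refine ⟨⟨x, hw, hx2⟩, rfl, ?_⟩
    rw [LinearPMap.neg_apply]
    refine Prod.ext (incl_injective A ?_) ?_
    · rw [h1]; exact neg_neg x.2
    · change -(A.op ⟨A.incl x.1, hw⟩ + k • x.2) = y.2
      rw [hw']; abel

/-- A limit of difference quotients in `Y` passes to each mode. The converse cannot be read off the
modes directly, since their convergence is not uniform; it goes through the integral formula `S(t)x
- x = ∫ S(s)y ds`, whose right side is differentiable in `Y`. -/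
theorem tendsto_waveGroup_iff (x y : A.Y) :
    Tendsto (fun t : ℝ => t⁻¹ • (waveGroup A k t x - x)) (𝓝[>] 0) (𝓝 y) ↔
      ∀ n, mode A n y = modeGen (freq A n) k (mode A n x) := by
  constructor
  · intro h n
    have h1 := ((mode A n).continuous.tendsto y).comp h
    have h2 := (hasDerivWithinAt_iff_tendsto_slope' (s := Ioi 0) (by simp)).1
      (hasDerivAt_modeExp_apply (freq A n) k 0 (mode A n x)).hasDerivWithinAt
    simp only [modeExp_zero, ContinuousLinearMap.id_apply] at h2
    refine tendsto_nhds_unique (h1.congr fun t => ?_) (by simpa using h2)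
    simp [slope, mode_waveGroup]
  · intro h
    have hint : ∀ t, ∫ s in (0 : ℝ)..t, waveGroup A k s y = waveGroup A k t x - x := by
      intro t
      refine mode_ext A fun n => ?_
      rw [← ContinuousLinearMap.intervalIntegral_comp_comm _
        ((continuous_waveGroup_apply A k y).intervalIntegrable _ _)]
      simp only [mode_waveGroup, h n, map_sub]
      rw [intervalIntegral.integral_eq_sub_of_hasDerivAt
        (fun s _ => hasDerivAt_modeExp_apply' (freq A n) k s (mode A n x))
        ((continuous_modeExp_apply _ _ _).intervalIntegrable _ _)]
      simp
    have hd : HasDerivAt (fun t => ∫ s in (0 : ℝ)..t, waveGroup A k s y) y 0 := by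
      have := (continuous_waveGroup_apply A k y).integral_hasStrictDerivAt 0 0
      simpa [waveGroup_zero] using this.hasDerivAt
    refine ((hasDerivWithinAt_iff_tendsto_slope' (s := Ioi 0) (by simp)).1
      hd.hasDerivWithinAt).congr fun t => ?_
    simp [slope, hint]

theorem isGenerator_waveGroup : IsGenerator (waveGroup A k) (-(A.blockOp k)) := fun x y =>
  (mem_graph_neg_blockOp_iff A k x y).trans (tendsto_waveGroup_iff A k x y).symm

end Generator

/-! ### The inhomogeneous linear problem -/

section Duhamel

variable {H : Type*} [NormedAddCommGroup H] [InnerProductSpace ℝ H] [CompleteSpace H]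
variable (A : PosDiscreteOp H) (k : ℝ)

/-- The right-hand side of Duhamel's formula for `U' + 𝒜 U = (0, f)`, `U(0) = U₀`. -/
def forcedFlow (U₀ : A.Y) (f : ℝ → H) (t : ℝ) : A.Y :=
  waveGroup A k t U₀ + ∫ s in (0 : ℝ)..t, waveGroup A k (t - s) ((0, f s) : A.Y)

variable {A k} {U₀ : A.Y} {f : ℝ → H}

theorem continuous_waveGroup_forcing (hf : Continuous f) :
    Continuous fun s => waveGroup A k (-s) ((0, f s) : A.Y) :=
  continuous_waveGroup A k continuous_neg (continuous_const.prodMk hf)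

/-- Because negative times are available, `S(t)` can be taken out of the integral. The integrand no
longer depends on `t`, so continuity and differentiation reduce to the product and primitive rules.
-/
theorem forcedFlow_eq (hf : Continuous f) (t : ℝ) :
    forcedFlow A k U₀ f t = waveGroup A k t
      (U₀ + ∫ s in (0 : ℝ)..t, waveGroup A k (-s) ((0, f s) : A.Y)) := by
  rw [forcedFlow, map_add, ← ContinuousLinearMap.intervalIntegral_comp_comm _
    ((continuous_waveGroup_forcing hf).intervalIntegrable _ _)]
  simp only [← waveGroup_add_apply, sub_eq_add_neg]

theorem continuous_forcedFlow (hf : Continuous f) : Continuous (forcedFlow A k U₀ f) := by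
  simp only [funext (forcedFlow_eq (U₀ := U₀) (k := k) hf)]
  refine continuous_waveGroup A k continuous_id (continuous_const.add ?_)
  exact intervalIntegral.continuous_primitive
    (fun a b => (continuous_waveGroup_forcing hf).intervalIntegrable _ _) 0

@[simp] theorem forcedFlow_zero : forcedFlow A k U₀ f 0 = U₀ := by
  simp [forcedFlow, waveGroup_zero]

/-- In a single mode the generator is bounded, so Duhamel's formula gives a classical solution
although `forcedFlow` need not be differentiable in `Y`. -/
theorem hasDerivAt_mode_forcedFlow (hf : Continuous f) (n : ℕ) (t : ℝ) :
    HasDerivAt (fun t => mode A n (forcedFlow A k U₀ f t))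
      (modeGen (freq A n) k (mode A n (forcedFlow A k U₀ f t)) + (0, A.basis.repr (f t) n)) t := by
  have hI : ∀ s, mode A n (waveGroup A k (-s) ((0, f s) : A.Y)) =
      modeExp (freq A n) k (-s) (0, A.basis.repr (f s) n) := by
    intro s; rw [mode_waveGroup, mode_apply]; simp
  have hc : Continuous fun s => mode A n (waveGroup A k (-s) ((0, f s) : A.Y)) :=
    (mode A n).continuous.comp (continuous_waveGroup_forcing hf)
  have heq : ∀ t, mode A n (forcedFlow A k U₀ f t) = modeExp (freq A n) k t (mode A n U₀ +
      ∫ s in (0 : ℝ)..t, mode A n (waveGroup A k (-s) ((0, f s) : A.Y))) := by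
    intro t
    rw [forcedFlow_eq hf, mode_waveGroup, map_add, ContinuousLinearMap.intervalIntegral_comp_comm _
      ((continuous_waveGroup_forcing hf).intervalIntegrable _ _)]
  have hd := (hasDerivAt_modeExp (freq A n) k t).clm_apply
    ((hc.integral_hasStrictDerivAt 0 t).hasDerivAt.const_add (mode A n U₀))
  rw [← funext heq] at hd
  refine hd.congr_deriv ?_
  rw [heq t, hI t]
  congr 1
  rw [← ContinuousLinearMap.comp_apply, ← modeExp_add]
  simp

/-- The first mode equation is integrated and divided by `freq A n > 0`. This makes the position
continuously differentiable in `H`, with the second component as velocity. -/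
theorem incl_forcedFlow (hf : Continuous f) (t : ℝ) :
    A.incl (forcedFlow A k U₀ f t).1 = A.incl U₀.1 + ∫ s in (0 : ℝ)..t, (forcedFlow A k U₀ f s).2 := by
  have hc : Continuous fun s => (forcedFlow A k U₀ f s).2 := (continuous_forcedFlow hf).snd
  refine A.basis.repr.injective ?_
  ext n
  have hn := freq_pos A n
  have h1 : ∫ s in (0 : ℝ)..t, freq A n * A.basis.repr (forcedFlow A k U₀ f s).2 n =
      freq A n * A.basis.repr (A.incl (forcedFlow A k U₀ f t).1) n -
        freq A n * A.basis.repr (A.incl U₀.1) n := by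
    have := intervalIntegral.integral_eq_sub_of_hasDerivAt (a := 0) (b := t)
      (f := fun s => (mode A n (forcedFlow A k U₀ f s)).1)
      (f' := fun s => freq A n * A.basis.repr (forcedFlow A k U₀ f s).2 n) (fun s _ => ?_) ?_
    · simpa [mode_apply, A.repr_sqrtOp] using this
    · have := hasFDerivAt_fst.comp_hasDerivAt s (hasDerivAt_mode_forcedFlow (k := k) (U₀ := U₀) hf n s)
      simpa [mode_apply, Function.comp_def] using this
    · refine Continuous.intervalIntegrable (continuous_const.mul ?_) _ _
      simpa [Function.comp_def] using (coordL A n).continuous.comp hc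
  have h2 : A.basis.repr (∫ s in (0 : ℝ)..t, (forcedFlow A k U₀ f s).2) n =
      ∫ s in (0 : ℝ)..t, A.basis.repr (forcedFlow A k U₀ f s).2 n := by
    simp only [← coordL_apply]
    exact ((coordL A n).intervalIntegral_comp_comm (hc.intervalIntegrable _ _)).symm
  rw [intervalIntegral.integral_const_mul, ← mul_sub] at h1
  have h3 := mul_left_cancel₀ hn.ne' h1
  rw [map_add, lp.coeFn_add, Pi.add_apply, h2, h3]
  ring

theorem hasDerivAt_incl_forcedFlow (hf : Continuous f) (t : ℝ) :
    HasDerivAt (fun t => A.incl (forcedFlow A k U₀ f t).1) (forcedFlow A k U₀ f t).2 t := by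
  rw [funext (incl_forcedFlow (k := k) (U₀ := U₀) hf)]
  exact ((continuous_forcedFlow hf).snd.integral_hasStrictDerivAt 0 t).hasDerivAt.const_add _

/-- The energy equality for the inhomogeneous linear problem. -/
theorem energy_forcedFlow (hf : Continuous f) (t : ℝ) :
    1 / 2 * (‖(forcedFlow A k U₀ f t).2‖ ^ 2 + ‖(forcedFlow A k U₀ f t).1‖ ^ 2) -
        1 / 2 * (‖U₀.2‖ ^ 2 + ‖U₀.1‖ ^ 2) =
      ∫ s in (0 : ℝ)..t, (-(k * ‖(forcedFlow A k U₀ f s).2‖ ^ 2) +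
        inner ℝ (f s) (forcedFlow A k U₀ f s).2) := by
  set U := forcedFlow A k U₀ f with hU
  have hc : Continuous fun s => (U s).2 := (continuous_forcedFlow hf).snd
  have hcr : ∀ n {g : ℝ → H}, Continuous g → Continuous fun s => A.basis.repr (g s) n :=
    fun n g hg => by simpa [Function.comp_def] using (coordL A n).continuous.comp hg
  have hint : ∀ n, ∫ s in (0 : ℝ)..t, (-(k * A.basis.repr (U s).2 n ^ 2) +
        A.basis.repr (f s) n * A.basis.repr (U s).2 n) =
      1 / 2 * ((mode A n (U t)).1 ^ 2 + (mode A n (U t)).2 ^ 2) -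
        1 / 2 * ((mode A n U₀).1 ^ 2 + (mode A n U₀).2 ^ 2) := by
    intro n
    have := intervalIntegral.integral_eq_sub_of_hasDerivAt (a := 0) (b := t)
      (f := fun s => 1 / 2 * ((mode A n (U s)).1 ^ 2 + (mode A n (U s)).2 ^ 2))
      (f' := fun s => -(k * A.basis.repr (U s).2 n ^ 2) +
        A.basis.repr (f s) n * A.basis.repr (U s).2 n) (fun s _ => ?_) ?_
    · simpa [hU] using this
    · have hd := hasDerivAt_mode_forcedFlow (k := k) (U₀ := U₀) hf n s
      have h1 := (hasFDerivAt_fst.comp_hasDerivAt s hd).fun_pow 2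
      have h2 := (hasFDerivAt_snd.comp_hasDerivAt s hd).fun_pow 2
      refine ((h1.add h2).const_mul (1 / 2)).congr_deriv ?_
      simp [mode_apply, ← hU]
      ring
    · exact Continuous.intervalIntegrable (((continuous_const.mul ((hcr n hc).pow 2)).neg).add
        ((hcr n hf).mul (hcr n hc))) _ _
  have hsum1 := ((hasSum_mode_sq A (U t)).mul_left (1 / 2)).sub
    ((hasSum_mode_sq A U₀).mul_left (1 / 2))
  -- The identities of the single modes are summed under the integral; `|f_n y_n| ≤ f_n² + y_n²`
  -- provides a dominating series whose sum is continuous in time.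
  have hsum2 := intervalIntegral.hasSum_integral_of_dominated_convergence (μ := MeasureTheory.volume)
    (a := 0) (b := t)
    (F := fun n s => -(k * A.basis.repr (U s).2 n ^ 2) +
      A.basis.repr (f s) n * A.basis.repr (U s).2 n)
    (f := fun s => -(k * ‖(U s).2‖ ^ 2) + inner ℝ (f s) (U s).2)
    (fun n s => (|k| + 1) * A.basis.repr (U s).2 n ^ 2 + A.basis.repr (f s) n ^ 2)
    (fun n => (Continuous.aestronglyMeasurable (((continuous_const.mul ((hcr n hc).pow 2)).neg).add
        ((hcr n hf).mul (hcr n hc))))) (fun n => ?_) ?_ ?_ ?_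
  · simp only [hint] at hsum2
    rw [hsum2.unique hsum1]
    ring
  · refine Eventually.of_forall fun s _ => ?_
    rw [Real.norm_eq_abs]
    refine (abs_add_le _ _).trans ?_
    rw [abs_neg, abs_mul, abs_mul, abs_of_nonneg (sq_nonneg (A.basis.repr (U s).2 n))]
    nlinarith [sq_nonneg (|A.basis.repr (f s) n| - |A.basis.repr (U s).2 n|),
      sq_abs (A.basis.repr (f s) n), sq_abs (A.basis.repr (U s).2 n),
      sq_nonneg (A.basis.repr (f s) n), sq_nonneg (A.basis.repr (U s).2 n)]
  · exact Eventually.of_forall fun s _ => (((hasSum_repr_sq A.basis (U s).2).mul_left _).add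
      (hasSum_repr_sq A.basis (f s))).summable
  · have : (fun s => ∑' n, ((|k| + 1) * A.basis.repr (U s).2 n ^ 2 + A.basis.repr (f s) n ^ 2)) =
        fun s => (|k| + 1) * ‖(U s).2‖ ^ 2 + ‖f s‖ ^ 2 :=
      funext fun s => (((hasSum_repr_sq A.basis (U s).2).mul_left _).add
        (hasSum_repr_sq A.basis (f s))).tsum_eq
    rw [this]
    exact Continuous.intervalIntegrable (by fun_prop) _ _
  · exact Eventually.of_forall fun s _ => ((hasSum_repr_sq A.basis (U s).2).mul_left _).neg.add
      (hasSum_repr_mul_repr A.basis (f s) (U s).2)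

/-- Continuous dependence for the inhomogeneous linear problem. -/
theorem norm_forcedFlow_sub_le {V₀ : A.Y} {g : ℝ → H} (hf : Continuous f) (hg : Continuous g) {T t : ℝ}
    (ht : 0 ≤ t) (htT : t ≤ T) :
    ‖forcedFlow A k U₀ f t - forcedFlow A k V₀ g t‖ ≤
      2 * Real.exp (|k| * T) * (‖U₀ - V₀‖ + ∫ s in (0 : ℝ)..t, ‖f s - g s‖) := by
  have hF : ∀ {f : ℝ → H}, Continuous f → Continuous fun s =>
      waveGroup A k (t - s) ((0, f s) : A.Y) := fun hf =>
    continuous_waveGroup A k (continuous_const.sub continuous_id) (continuous_const.prodMk hf)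
  have h1 : forcedFlow A k U₀ f t - forcedFlow A k V₀ g t = waveGroup A k t (U₀ - V₀) +
      ∫ s in (0 : ℝ)..t, waveGroup A k (t - s) ((0, f s - g s) : A.Y) := by
    have : ∀ s, waveGroup A k (t - s) ((0, f s - g s) : A.Y) =
        waveGroup A k (t - s) ((0, f s) : A.Y) - waveGroup A k (t - s) ((0, g s) : A.Y) := by
      intro s; rw [← map_sub]; simp
    simp only [this]
    rw [intervalIntegral.integral_sub ((hF hf).intervalIntegrable _ _)
      ((hF hg).intervalIntegrable _ _), map_sub, forcedFlow, forcedFlow]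
    abel
  have hexp : ∀ s ∈ Icc (0 : ℝ) t, ∀ x : A.Y,
      ‖waveGroup A k (t - s) x‖ ≤ 2 * Real.exp (|k| * T) * ‖x‖ := by
    intro s hs x
    refine (norm_waveGroup_apply_le A k _ x).trans ?_
    have : |t - s| ≤ T := by rw [abs_of_nonneg (by linarith [hs.2])]; linarith [hs.1]
    gcongr
  rw [h1, mul_add]
  refine (norm_add_le _ _).trans (add_le_add ?_ ?_)
  · simpa using hexp 0 ⟨le_rfl, ht⟩ (U₀ - V₀)
  · rw [← intervalIntegral.integral_const_mul]
    refine intervalIntegral.norm_integral_le_of_norm_le ht ?_ ?_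
    · refine Eventually.of_forall fun s hs => (hexp s ⟨hs.1.le, hs.2⟩ _).trans_eq ?_
      rw [Prod.norm_mk]; simp
    · exact Continuous.intervalIntegrable (by fun_prop) _ _

end Duhamel

/-! ### The phase space -/

section PhaseSpace

variable {H : Type*} [NormedAddCommGroup H] [InnerProductSpace ℝ H] [CompleteSpace H]
variable {A : PosDiscreteOp H} {h : ℝ}

theorem extendH_apply (φ : Icc (-h) 0 → A.DHalf) (θ : Icc (-h) 0) :
    extendH A h φ θ = A.incl (φ θ) :=
  Subtype.val_injective.extend_apply _ _ _

theorem continuous_dot (hh : 0 < h) (φ : W A h) : Continuous (dot φ) :=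
  continuousOn_iff_continuous_domRestrict.1
    (φ.2.2.continuousOn_derivWithin (uniqueDiffOn_Icc (by linarith)) le_rfl)

theorem hasDerivWithinAt_extendH (φ : W A h) (θ : Icc (-h) 0) :
    HasDerivWithinAt (extendH A h φ.1) (dot φ θ) (Icc (-h) 0) θ :=
  (φ.2.2.differentiableOn one_ne_zero θ θ.2).hasDerivWithinAt

theorem bddAbove_range_norm {E : Type*} [SeminormedAddCommGroup E] {f : Icc (-h) 0 → E}
    (hf : Continuous f) : BddAbove (range fun θ => ‖f θ‖) :=
  (isCompact_range hf.norm).bddAbove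

theorem nonempty_Icc_delay (hh : 0 < h) : Nonempty (Icc (-h) 0) := ⟨⟨0, by simp [hh.le]⟩⟩

theorem normW_nonneg (φ : W A h) : 0 ≤ normW φ :=
  add_nonneg (Real.iSup_nonneg fun _ => norm_nonneg _) (Real.iSup_nonneg fun _ => norm_nonneg _)

theorem distW_nonneg (φ ψ : W A h) : 0 ≤ distW φ ψ :=
  add_nonneg (Real.iSup_nonneg fun _ => norm_nonneg _) (Real.iSup_nonneg fun _ => norm_nonneg _)

theorem distW_comm (φ ψ : W A h) : distW φ ψ = distW ψ φ := by
  simp only [distW, norm_sub_rev]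

theorem distW_self (φ : W A h) : distW φ φ = 0 := by simp [distW]

theorem norm_le_normW (φ : W A h) (θ : Icc (-h) 0) : ‖φ.1 θ‖ ≤ normW φ :=
  (le_ciSup (bddAbove_range_norm φ.2.1) θ).trans
    (le_add_of_nonneg_right (Real.iSup_nonneg fun _ => norm_nonneg _))

theorem norm_dot_le_normW (hh : 0 < h) (φ : W A h) (θ : Icc (-h) 0) : ‖dot φ θ‖ ≤ normW φ :=
  (le_ciSup (bddAbove_range_norm (continuous_dot hh φ)) θ).trans
    (le_add_of_nonneg_left (Real.iSup_nonneg fun _ => norm_nonneg _))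

theorem norm_sub_le_distW (φ ψ : W A h) (θ : Icc (-h) 0) : ‖φ.1 θ - ψ.1 θ‖ ≤ distW φ ψ :=
  (le_ciSup (bddAbove_range_norm (φ.2.1.sub ψ.2.1)) θ).trans
    (le_add_of_nonneg_right (Real.iSup_nonneg fun _ => norm_nonneg _))

theorem norm_dot_sub_le_distW (hh : 0 < h) (φ ψ : W A h) (θ : Icc (-h) 0) :
    ‖dot φ θ - dot ψ θ‖ ≤ distW φ ψ :=
  (le_ciSup (bddAbove_range_norm ((continuous_dot hh φ).sub (continuous_dot hh ψ))) θ).trans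
    (le_add_of_nonneg_left (Real.iSup_nonneg fun _ => norm_nonneg _))

theorem normW_le (hh : 0 < h) {φ : W A h} {a b : ℝ} (ha : ∀ θ, ‖φ.1 θ‖ ≤ a)
    (hb : ∀ θ, ‖dot φ θ‖ ≤ b) : normW φ ≤ a + b :=
  have := nonempty_Icc_delay hh
  add_le_add (ciSup_le ha) (ciSup_le hb)

theorem distW_le (hh : 0 < h) {φ ψ : W A h} {a b : ℝ} (ha : ∀ θ, ‖φ.1 θ - ψ.1 θ‖ ≤ a)
    (hb : ∀ θ, ‖dot φ θ - dot ψ θ‖ ≤ b) : distW φ ψ ≤ a + b :=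
  have := nonempty_Icc_delay hh
  add_le_add (ciSup_le ha) (ciSup_le hb)

/-- `W A h` is a subtype without a subtraction of its own, so the triangle inequality is obtained
pointwise and then for the suprema. -/
theorem normW_le_add_distW (hh : 0 < h) (φ ψ : W A h) : normW φ ≤ normW ψ + distW φ ψ := by
  refine (normW_le hh (a := (⨆ θ, ‖ψ.1 θ‖) + ⨆ θ, ‖φ.1 θ - ψ.1 θ‖)
    (b := (⨆ θ, ‖dot ψ θ‖) + ⨆ θ, ‖dot φ θ - dot ψ θ‖) (fun θ => ?_) fun θ => ?_).trans_eq ?_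
  · exact (norm_le_norm_add_norm_sub' _ _).trans (add_le_add
      (le_ciSup (bddAbove_range_norm ψ.2.1) θ)
      (le_ciSup (bddAbove_range_norm (φ.2.1.sub ψ.2.1)) θ))
  · exact (norm_le_norm_add_norm_sub' _ _).trans (add_le_add
      (le_ciSup (bddAbove_range_norm (continuous_dot hh ψ)) θ)
      (le_ciSup (bddAbove_range_norm ((continuous_dot hh φ).sub (continuous_dot hh ψ))) θ))
  · rw [normW, distW]; ring

theorem abs_normW_sub_le (hh : 0 < h) (φ ψ : W A h) : |normW φ - normW ψ| ≤ distW φ ψ := by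
  have h1 := normW_le_add_distW hh φ ψ
  have h2 := normW_le_add_distW hh ψ φ
  rw [distW_comm] at h2
  exact abs_le.2 ⟨by linarith, by linarith⟩

/-- A function of the delay variable with a continuous `H`-derivative belongs to `W`. -/
theorem mem_W_of_hasDerivWithinAt (hh : 0 < h) {φ : Icc (-h) 0 → A.DHalf} (hφ : Continuous φ)
    {w : ℝ → H} (hw : ContinuousOn w (Icc (-h) 0))
    (hd : ∀ θ ∈ Icc (-h) 0, HasDerivWithinAt (extendH A h φ) (w θ) (Icc (-h) 0) θ) :
    φ ∈ W A h := by
  have hu := uniqueDiffOn_Icc (show -h < 0 by linarith)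
  refine ⟨hφ, (contDiffOn_one_iff_derivWithin hu).2
    ⟨fun θ hθ => (hd θ hθ).differentiableWithinAt, hw.congr fun θ hθ => ?_⟩⟩
  exact (hd θ hθ).derivWithin (hu θ hθ)

end PhaseSpace

/-! ### Paths and their histories -/

section Paths

variable {H : Type*} [NormedAddCommGroup H] [InnerProductSpace ℝ H] [CompleteSpace H]
variable {A : PosDiscreteOp H} {h : ℝ}

theorem IsTimeInterval.uniqueDiffOn (hh : 0 < h) {J : Set ℝ} (hJ : IsTimeInterval h J) :
    UniqueDiffOn ℝ J := by
  refine uniqueDiffOn_convex hJ.1.convex ⟨-h / 2, ?_⟩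
  refine interior_mono hJ.2.1 ?_
  rw [interior_Icc]
  constructor <;> linarith

theorem IsTimeInterval.neg_mem (hh : 0 < h) {J : Set ℝ} (hJ : IsTimeInterval h J) : -h ∈ J :=
  hJ.2.1 ⟨le_rfl, by linarith⟩

theorem IsTimeInterval.zero_mem (hh : 0 < h) {J : Set ℝ} (hJ : IsTimeInterval h J) : 0 ∈ J :=
  hJ.2.1 ⟨by linarith, le_rfl⟩

theorem IsTimeInterval.mem (hh : 0 < h) {J : Set ℝ} (hJ : IsTimeInterval h J) {s t : ℝ}
    (ht : t ∈ J) (hs : -h ≤ s) (hst : s ≤ t) : s ∈ J :=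
  hJ.1.out (hJ.neg_mem hh) ht ⟨hs, hst⟩

/-- `u` is continuous in `D(A^{1/2})` and has the continuous `H`-derivative `v` on `J`. -/
structure IsPath (J : Set ℝ) (u : ℝ → A.DHalf) (v : ℝ → H) : Prop where
  continuousOn : ContinuousOn u J
  continuousOn_vel : ContinuousOn v J
  hasDeriv : ∀ t ∈ J, HasDerivWithinAt (fun s => A.incl (u s)) (v t) J t

variable {J : Set ℝ} {u u₁ u₂ : ℝ → A.DHalf} {v v₁ v₂ : ℝ → H}

theorem IsPath.mono {J' : Set ℝ} (hp : IsPath J u v) (hJ : J' ⊆ J) : IsPath J' u v :=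
  ⟨hp.continuousOn.mono hJ, hp.continuousOn_vel.mono hJ, fun t ht =>
    (hp.hasDeriv t (hJ ht)).mono hJ⟩

theorem IsPath.congr (hp : IsPath J u₁ v₁) (hu : EqOn u₂ u₁ J) (hv : EqOn v₂ v₁ J) :
    IsPath J u₂ v₂ :=
  ⟨hp.continuousOn.congr hu, hp.continuousOn_vel.congr hv, fun t ht => by
    rw [hv ht]
    exact (hp.hasDeriv t ht).congr (fun s hs => by rw [hu hs]) (by rw [hu ht])⟩

theorem IsPath.contDiffOn (hJ : UniqueDiffOn ℝ J) (hp : IsPath J u v) :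
    ContDiffOn ℝ 1 (fun t => A.incl (u t)) J :=
  (contDiffOn_one_iff_derivWithin hJ).2
    ⟨fun t ht => (hp.hasDeriv t ht).differentiableWithinAt, hp.continuousOn_vel.congr fun t ht =>
      (hp.hasDeriv t ht).derivWithin (hJ t ht)⟩

theorem IsPath.velocity_eq (hJ : UniqueDiffOn ℝ J) (hp : IsPath J u v) {t : ℝ} (ht : t ∈ J) :
    velocity J u t = v t :=
  (hp.hasDeriv t ht).derivWithin (hJ t ht)

theorem isPath_velocity (hJ : UniqueDiffOn ℝ J) (hu : ContinuousOn u J)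
    (hu' : ContDiffOn ℝ 1 (fun t => A.incl (u t)) J) : IsPath J u (velocity J u) :=
  ⟨hu, hu'.continuousOn_derivWithin hJ le_rfl, fun t ht =>
    (hu'.differentiableOn one_ne_zero t ht).hasDerivWithinAt⟩

/-- Chain rule for the translation `θ ↦ t + θ`; the condition `0 ≤ t` keeps `t + θ` above `-h`,
inside the interval. -/
theorem IsPath.hasDerivWithinAt_history (hh : 0 < h) (hJ : IsTimeInterval h J)
    (hp : IsPath J u v) {t : ℝ} (ht : t ∈ J) (ht0 : 0 ≤ t) {θ : ℝ} (hθ : θ ∈ Icc (-h) 0) :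
    HasDerivWithinAt (extendH A h (history h u t)) (v (t + θ)) (Icc (-h) 0) θ := by
  have hmem : MapsTo (fun θ => t + θ) (Icc (-h) 0) J := fun s hs =>
    hJ.mem hh ht (by linarith [hs.1]) (by linarith [hs.2])
  have h1 := (hp.hasDeriv (t + θ) (hmem hθ)).scomp θ
    (((hasDerivAt_id θ).const_add t).hasDerivWithinAt (s := Icc (-h) 0)) hmem
  rw [one_smul] at h1
  refine h1.congr (fun s hs => ?_) ?_
  · exact extendH_apply (history h u t) ⟨s, hs⟩
  · exact extendH_apply (history h u t) ⟨θ, hθ⟩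

theorem IsPath.history_mem (hh : 0 < h) (hJ : IsTimeInterval h J) (hp : IsPath J u v) {t : ℝ}
    (ht : t ∈ J) (ht0 : 0 ≤ t) : history h u t ∈ W A h := by
  have hmem : MapsTo (fun θ => t + θ) (Icc (-h) 0) J := fun s hs =>
    hJ.mem hh ht (by linarith [hs.1]) (by linarith [hs.2])
  have hc : ContinuousOn (fun θ => t + θ) (Icc (-h) 0) := by fun_prop
  exact mem_W_of_hasDerivWithinAt hh
    (continuousOn_iff_continuous_domRestrict.1 (hp.continuousOn.comp hc hmem))
    (hp.continuousOn_vel.comp hc hmem)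
    fun θ hθ => hp.hasDerivWithinAt_history hh hJ ht ht0 hθ

theorem IsPath.dot_history (hh : 0 < h) (hJ : IsTimeInterval h J) (hp : IsPath J u v) {t : ℝ}
    (ht : t ∈ J) (ht0 : 0 ≤ t) (hm : history h u t ∈ W A h) (θ : Icc (-h) 0) :
    dot ⟨history h u t, hm⟩ θ = v (t + θ) :=
  (hp.hasDerivWithinAt_history hh hJ ht ht0 θ.2).derivWithin
    (uniqueDiffOn_Icc (by linarith) θ θ.2)

theorem IsPath.normW_history_le (hh : 0 < h) (hJ : IsTimeInterval h J) (hp : IsPath J u v) {t : ℝ}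
    (ht : t ∈ J) (ht0 : 0 ≤ t) (hm : history h u t ∈ W A h) {a b : ℝ}
    (ha : ∀ s ∈ Icc (-h) t, ‖u s‖ ≤ a) (hb : ∀ s ∈ Icc (-h) t, ‖v s‖ ≤ b) :
    normW ⟨history h u t, hm⟩ ≤ a + b := by
  have hmem : ∀ θ : Icc (-h) 0, t + θ ∈ Icc (-h) t := fun θ =>
    ⟨by linarith [θ.2.1], by linarith [θ.2.2]⟩
  refine normW_le hh (fun θ => ha _ (hmem θ)) fun θ => ?_
  rw [hp.dot_history hh hJ ht ht0]
  exact hb _ (hmem θ)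

theorem IsPath.distW_history_le (hh : 0 < h) (hJ : IsTimeInterval h J) (hp₁ : IsPath J u₁ v₁)
    (hp₂ : IsPath J u₂ v₂) {s t : ℝ} (hs : s ∈ J) (hs0 : 0 ≤ s) (ht : t ∈ J) (ht0 : 0 ≤ t)
    (hm₁ : history h u₁ s ∈ W A h) (hm₂ : history h u₂ t ∈ W A h) {a b : ℝ}
    (ha : ∀ θ ∈ Icc (-h) 0, ‖u₁ (s + θ) - u₂ (t + θ)‖ ≤ a)
    (hb : ∀ θ ∈ Icc (-h) 0, ‖v₁ (s + θ) - v₂ (t + θ)‖ ≤ b) :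
    distW ⟨history h u₁ s, hm₁⟩ ⟨history h u₂ t, hm₂⟩ ≤ a + b := by
  refine distW_le hh (fun θ => ha θ θ.2) fun θ => ?_
  rw [hp₁.dot_history hh hJ hs hs0, hp₂.dot_history hh hJ ht ht0]
  exact hb θ θ.2

/-- The value `G(u_t)` of a function on `W`, extended by zero. -/
def evalHistory {E : Type*} [Zero E] (G : W A h → E) (u : ℝ → A.DHalf) (t : ℝ) : E :=
  Function.extend Subtype.val G 0 (history h u t)

theorem evalHistory_eq {E : Type*} [Zero E] (G : W A h → E) {t : ℝ}
    (hm : history h u t ∈ W A h) : evalHistory G u t = G ⟨history h u t, hm⟩ :=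
  Subtype.val_injective.extend_apply G 0 ⟨history h u t, hm⟩

theorem delayTerm_eq (M : W A h → H) {t : ℝ} (hm : history h u t ∈ W A h) :
    delayTerm M u t = M ⟨history h u t, hm⟩ :=
  evalHistory_eq M hm

theorem IsPath.exists_bound {T : ℝ} (hp : IsPath (Icc (-h) T) u v) :
    ∃ R > 0, ∀ s ∈ Icc (-h) T, ‖u s‖ ≤ R ∧ ‖v s‖ ≤ R := by
  obtain ⟨R₁, h₁⟩ := isCompact_Icc.exists_bound_of_continuousOn hp.continuousOn
  obtain ⟨R₂, h₂⟩ := isCompact_Icc.exists_bound_of_continuousOn hp.continuousOn_vel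
  exact ⟨max 1 (max R₁ R₂), by positivity, fun s hs => ⟨(h₁ s hs).trans (by simp),
    (h₂ s hs).trans (by simp)⟩⟩

/-- A locally Lipschitz function on `W` is continuous along histories. -/
theorem IsPath.continuousOn_evalHistory {E : Type*} [NormedAddCommGroup E] (hh : 0 < h)
    (hJ : IsTimeInterval h J) (hp : IsPath J u v) {G : W A h → E}
    (hG : ∀ ρ > 0, ∃ C : ℝ, ∀ φ₁ φ₂ : W A h, normW φ₁ ≤ ρ → normW φ₂ ≤ ρ →
      ‖G φ₁ - G φ₂‖ ≤ C * distW φ₁ φ₂) {T : ℝ} (hT : T ∈ J) :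
    ContinuousOn (evalHistory G u) (Icc 0 T) := by
  have hsub : Icc (-h) T ⊆ J := fun s hs => hJ.mem hh hT hs.1 hs.2
  have hsub0 : Icc 0 T ⊆ J := fun s hs => hJ.mem hh hT (by linarith [hs.1]) hs.2
  obtain ⟨R, hR0, hR⟩ := (hp.mono hsub).exists_bound
  obtain ⟨C, hC⟩ := hG (R + R) (by linarith)
  have hmem : ∀ t ∈ Icc 0 T, history h u t ∈ W A h := fun t ht =>
    hp.history_mem hh hJ (hsub0 ht) ht.1
  have hnorm : ∀ t (ht : t ∈ Icc 0 T), normW ⟨history h u t, hmem t ht⟩ ≤ R + R := fun t ht =>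
    hp.normW_history_le hh hJ (hsub0 ht) ht.1 _ (fun s hs => (hR s ⟨hs.1, hs.2.trans ht.2⟩).1)
      fun s hs => (hR s ⟨hs.1, hs.2.trans ht.2⟩).2
  have huu := isCompact_Icc.uniformContinuousOn_of_continuous (hp.continuousOn.mono hsub)
  have huv := isCompact_Icc.uniformContinuousOn_of_continuous (hp.continuousOn_vel.mono hsub)
  rw [Metric.uniformContinuousOn_iff] at huu huv
  rw [Metric.continuousOn_iff]
  intro t ht ε hε
  have hC' : 0 < |C| + 1 := by positivity
  -- Position and velocity each contribute `η` to the distance of histories, so the total is at most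
  -- `ε / 2`.
  set η := ε / (4 * (|C| + 1)) with hη
  have hη0 : 0 < η := by positivity
  obtain ⟨δ₁, hδ₁, h₁⟩ := huu η hη0
  obtain ⟨δ₂, hδ₂, h₂⟩ := huv η hη0
  refine ⟨min δ₁ δ₂, lt_min hδ₁ hδ₂, fun s hs hst => ?_⟩
  rw [evalHistory_eq G (hmem s hs), evalHistory_eq G (hmem t ht), dist_eq_norm]
  have hd : distW (⟨history h u s, hmem s hs⟩ : W A h) ⟨history h u t, hmem t ht⟩ ≤ η + η := by
    have hθ : ∀ {r θ : ℝ}, r ∈ Icc 0 T → θ ∈ Icc (-h) 0 → r + θ ∈ Icc (-h) T := fun hr hθ =>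
      ⟨by linarith [hr.1, hθ.1], by linarith [hr.2, hθ.2]⟩
    refine IsPath.distW_history_le hh hJ hp hp (hsub0 hs) hs.1 (hsub0 ht) ht.1 _ _
      (fun θ hθ' => ?_) fun θ hθ' => ?_
    · rw [← dist_eq_norm]
      exact (h₁ _ (hθ hs hθ') _ (hθ ht hθ') (by simpa using hst.trans_le (min_le_left _ _))).le
    · rw [← dist_eq_norm]
      exact (h₂ _ (hθ hs hθ') _ (hθ ht hθ') (by simpa using hst.trans_le (min_le_right _ _))).le
  calc _ ≤ C * distW _ _ := hC _ _ (hnorm s hs) (hnorm t ht)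
    _ ≤ (|C| + 1) * (η + η) := by
      refine mul_le_mul ?_ hd (distW_nonneg _ _) hC'.le
      linarith [le_abs_self C]
    _ < ε := by
      have : (|C| + 1) * (η + η) = ε / 2 := by rw [hη]; field_simp; ring
      linarith

end Paths

/-! ### Mild solutions -/

section Mild

variable {H : Type*} [NormedAddCommGroup H] [InnerProductSpace ℝ H] [CompleteSpace H]
variable {A : PosDiscreteOp H} {h k : ℝ} {F : A.DHalf → H} {M : W A h → H} {J : Set ℝ}
variable {φ : W A h} {u : ℝ → A.DHalf} {v : ℝ → H}

theorem HypF1.continuous (hF : HypF1 F) : Continuous F := by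
  rw [continuous_iff_continuousAt]
  intro u
  obtain ⟨L, hL⟩ := hF (‖u‖ + 1) (by positivity)
  have h1 : Tendsto (fun w => L * ‖w - u‖) (𝓝 u) (𝓝 0) := by
    have : Continuous fun w => L * ‖w - u‖ := by fun_prop
    simpa using this.tendsto u
  refine tendsto_iff_norm_sub_tendsto_zero.2
    (squeeze_zero' (Eventually.of_forall fun _ => norm_nonneg _) ?_ h1)
  filter_upwards [(continuous_norm (E := A.DHalf)).tendsto u |>.eventually
    (gt_mem_nhds (lt_add_one ‖u‖))] with w hw
  exact hL w u hw.le (by linarith)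

variable {S : ℝ → A.Y →L[ℝ] A.Y}

theorem IsMildSolution.isPath (hh : 0 < h) (hJ : IsTimeInterval h J)
    (hu : IsMildSolution S F M J φ u) : IsPath J u (velocity J u) :=
  isPath_velocity (hJ.uniqueDiffOn hh) hu.continuousOn hu.contDiffOn

theorem IsPath.isMildSolution (hh : 0 < h) (hJ : IsTimeInterval h J) (hp : IsPath J u v)
    (hi : ∀ θ : Icc (-h) 0, u θ = φ.1 θ)
    (hd : ∀ t ∈ J, 0 ≤ t → ((u t, v t) : A.Y) = S t (u 0, v 0) +
      ∫ s in (0 : ℝ)..t, S (t - s) (0, -F (u s) - delayTerm M u s)) :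
    IsMildSolution S F M J φ u where
  continuousOn := hp.continuousOn
  contDiffOn := hp.contDiffOn (hJ.uniqueDiffOn hh)
  initial := hi
  duhamel t ht ht0 := by
    rw [hp.velocity_eq (hJ.uniqueDiffOn hh) ht,
      hp.velocity_eq (hJ.uniqueDiffOn hh) (hJ.zero_mem hh)]
    exact hd t ht ht0

/-- `velocity` is a derivative within the interval and so depends on it formally. Both intervals
have unique derivatives, hence the values agree. -/
theorem velocity_mono (hh : 0 < h) (hJ : IsTimeInterval h J) {J' : Set ℝ}
    (hJ' : IsTimeInterval h J') (hsub : J' ⊆ J) (hu : IsMildSolution S F M J φ u) {t : ℝ}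
    (ht : t ∈ J') : velocity J' u t = velocity J u t :=
  ((hu.isPath hh hJ).mono hsub).velocity_eq (hJ'.uniqueDiffOn hh) ht

theorem IsMildSolution.mono (hh : 0 < h) (hJ : IsTimeInterval h J) {J' : Set ℝ}
    (hJ' : IsTimeInterval h J') (hsub : J' ⊆ J) (hu : IsMildSolution S F M J φ u) :
    IsMildSolution S F M J' φ u :=
  ((hu.isPath hh hJ).mono hsub).isMildSolution hh hJ' hu.initial
    fun t ht ht0 => hu.duhamel t (hsub ht) ht0

/-- On `[-h,0]` the velocity of a solution is the derivative of the initial function. -/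
theorem IsMildSolution.velocity_initial (hh : 0 < h) (hJ : IsTimeInterval h J)
    (hu : IsMildSolution S F M J φ u) (θ : Icc (-h) 0) : velocity J u θ = dot φ θ := by
  have h1 := ((hu.isPath hh hJ).hasDeriv θ (hJ.2.1 θ.2)).mono hJ.2.1
  have h2 := hasDerivWithinAt_extendH φ θ
  refine (uniqueDiffOn_Icc (show -h < 0 by linarith) θ θ.2).eq_deriv _ h1 (h2.congr ?_ ?_)
  · intro s hs
    rw [extendH_apply φ.1 ⟨s, hs⟩, ← hu.initial]
  · rw [extendH_apply φ.1 θ, ← hu.initial]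

theorem IsMildSolution.continuousOn_forcing (hh : 0 < h) (hJ : IsTimeInterval h J)
    (hF : Continuous F) (hM : HypM1 M) (hu : IsMildSolution S F M J φ u) {T : ℝ} (hT : T ∈ J) :
    ContinuousOn (fun s => -F (u s) - delayTerm M u s) (Icc 0 T) := by
  have hp := hu.isPath hh hJ
  have hsub : Icc 0 T ⊆ J := fun s hs => hJ.mem hh hT (by linarith [hs.1]) hs.2
  exact (hF.comp_continuousOn (hp.continuousOn.mono hsub)).neg.sub
    (hp.continuousOn_evalHistory hh hJ hM hT)

/-- On compact intervals, a mild solution solves the linear problem with a continuous forcing. -/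
theorem IsMildSolution.exists_forcing (hh : 0 < h) (hJ : IsTimeInterval h J)
    (hF : Continuous F) (hM : HypM1 M) (hu : IsMildSolution (waveGroup A k) F M J φ u) {T : ℝ}
    (hT : T ∈ J) (hT0 : 0 ≤ T) :
    ∃ f : ℝ → H, Continuous f ∧ (∀ s ∈ Icc 0 T, f s = -F (u s) - delayTerm M u s) ∧
      ∀ t ∈ Icc 0 T,
        ((u t, velocity J u t) : A.Y) = forcedFlow A k (u 0, velocity J u 0) f t := by
  have hc := hu.continuousOn_forcing hh hJ hF hM hT
  -- The forcing is extended from `[0,T]` to the line by its end values, so that results for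
  -- globally continuous forcings apply; the integrals only see `[0,T]`.
  refine ⟨IccExtend hT0 ((Icc 0 T).domRestrict fun s => -F (u s) - delayTerm M u s),
    (continuousOn_iff_continuous_domRestrict.1 hc).Icc_extend', fun s hs => ?_, fun t ht => ?_⟩
  · rw [IccExtend_of_mem hT0 _ hs]; rfl
  · have htJ : t ∈ J := hJ.mem hh hT (by linarith [ht.1]) ht.2
    rw [hu.duhamel t htJ ht.1, forcedFlow]
    congr 1
    refine intervalIntegral.integral_congr fun s hs => ?_
    rw [uIcc_of_le ht.1] at hs
    rw [IccExtend_of_mem hT0 _ ⟨hs.1, hs.2.trans ht.2⟩]; rfl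

end Mild

/-! ### Energy equality -/

theorem intervalIntegrable_of_continuousOn_Icc {g : ℝ → ℝ} {t : ℝ} (ht : 0 ≤ t)
    (hg : ContinuousOn g (Icc 0 t)) : IntervalIntegrable g MeasureTheory.volume 0 t := by
  rw [← uIcc_of_le ht] at hg
  exact hg.intervalIntegrable

theorem integral_sub_sub_of_continuousOn {a b c : ℝ → ℝ} {t : ℝ} (ht : 0 ≤ t)
    (ha : ContinuousOn a (Icc 0 t)) (hb : ContinuousOn b (Icc 0 t))
    (hc : ContinuousOn c (Icc 0 t)) :
    ∫ s in (0 : ℝ)..t, (a s - b s - c s) =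
      (∫ s in (0 : ℝ)..t, a s) - (∫ s in (0 : ℝ)..t, b s) - ∫ s in (0 : ℝ)..t, c s := by
  have hI := fun {g : ℝ → ℝ} => intervalIntegrable_of_continuousOn_Icc (g := g) ht
  rw [intervalIntegral.integral_sub ((hI ha).sub (hI hb)) (hI hc),
    intervalIntegral.integral_sub (hI ha) (hI hb)]

section Energy

variable {H : Type*} [NormedAddCommGroup H] [InnerProductSpace ℝ H] [CompleteSpace H]
variable {A : PosDiscreteOp H} {h k : ℝ} {F Fstar : A.DHalf → H} {Pi0 Pi1 : A.DHalf → ℝ}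
variable {M : W A h → H} {J : Set ℝ} {φ : W A h} {u : ℝ → A.DHalf} {v : ℝ → H}

theorem HypF2.continuous_Fstar (hF2 : HypF2 F Fstar Pi0 Pi1) : Continuous Fstar := by
  obtain ⟨c, hc⟩ := hF2.lipschitz
  rw [continuous_iff_continuousAt]
  intro u
  have h1 : Tendsto (fun w => √(c * ‖w - u‖ ^ 2)) (𝓝 u) (𝓝 0) := by
    have : Continuous fun w => √(c * ‖w - u‖ ^ 2) := by fun_prop
    simpa using this.tendsto u
  exact tendsto_iff_norm_sub_tendsto_zero.2
    (squeeze_zero (fun _ => norm_nonneg _) (fun w => Real.le_sqrt_of_sq_le (hc w u)) h1)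

theorem HypF2.exists_norm_Fstar_le (hF2 : HypF2 F Fstar Pi0 Pi1) :
    ∃ c, 0 ≤ c ∧ ∀ w, ‖Fstar w‖ ≤ ‖Fstar 0‖ + c * ‖w‖ := by
  obtain ⟨c₀, hc₀⟩ := hF2.lipschitz
  -- The absolute value is taken because no sign of `c₀` is given.
  refine ⟨√|c₀|, Real.sqrt_nonneg _, fun w => ?_⟩
  have h1 := hc₀ w 0
  have h2 : ‖Fstar w - Fstar 0‖ ≤ √|c₀| * ‖w‖ := by
    refine abs_le_of_sq_le_sq' ?_ (by positivity) |>.2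
    rw [mul_pow, Real.sq_sqrt (abs_nonneg _)]
    rw [sub_zero] at h1
    refine h1.trans ?_
    gcongr
    exact le_abs_self _
  exact (norm_le_norm_add_norm_sub' _ _).trans (by gcongr)

/-- The potential is differentiable with respect to the weaker norm of `H`. -/
theorem HypF2.isLittleO (hF1 : HypF1 F) (hF2 : HypF2 F Fstar Pi0 Pi1) (a : A.DHalf) :
    (fun w => Pi0 w + Pi1 w - (Pi0 a + Pi1 a) - inner ℝ (F a - Fstar a) (A.incl (w - a)))
      =o[𝓝 a] fun w => A.incl (w - a) := by
  have hG : Continuous fun w => F w - Fstar w := hF1.continuous.sub hF2.continuous_Fstar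
  rw [Asymptotics.isLittleO_iff]
  intro c hc
  obtain ⟨δ, hδ, hball⟩ := Metric.continuousAt_iff.1 (hG.continuousAt (x := a)) c hc
  filter_upwards [Metric.ball_mem_nhds a hδ] with w hw
  -- Along the segment from `a` to `w` the linear part at `a` is subtracted. The derivative left is
  -- the inner product of a change of `F - F*`, smaller than `c`, with the increment, so the mean
  -- value inequality gives a bound by the `H`-norm of the increment.
  have hd : ∀ τ : ℝ, HasDerivAt (fun τ : ℝ => Pi0 (a + τ • (w - a)) + Pi1 (a + τ • (w - a)) -
      τ * inner ℝ (F a - Fstar a) (A.incl (w - a)))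
      (inner ℝ (F (a + τ • (w - a)) - Fstar (a + τ • (w - a)) - (F a - Fstar a))
        (A.incl (w - a))) τ := by
    intro τ
    have h1 : HasDerivAt (fun τ : ℝ => a + τ • (w - a)) (w - a) τ := by
      simpa using ((hasDerivAt_id τ).smul_const (w - a)).const_add a
    have h2 := ((hF2.contDiff.differentiable one_ne_zero) (a + τ • (w - a))).hasFDerivAt.comp_hasDerivAt
      τ h1
    have h3 := (hasDerivAt_id τ).mul_const (inner ℝ (F a - Fstar a) (A.incl (w - a)) : ℝ)
    refine (h2.sub h3).congr_deriv ?_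
    rw [hF2.fderiv_eq, one_mul, ← inner_sub_left]
  have := norm_image_sub_le_of_norm_deriv_le_segment_01' (fun τ _ => (hd τ).hasDerivWithinAt)
    (C := c * ‖A.incl (w - a)‖) fun τ hτ => ?_
  · have e : a + (w - a) = w := by abel
    simp only [one_smul, zero_smul, add_zero, one_mul, zero_mul, sub_zero, e] at this
    rwa [sub_right_comm] at this
  · refine (norm_inner_le_norm _ _).trans ?_
    gcongr
    rw [← dist_eq_norm]
    refine (hball ?_).le
    rw [dist_eq_norm, add_sub_cancel_left, norm_smul, Real.norm_of_nonneg hτ.1]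
    refine lt_of_le_of_lt ?_ (mem_ball_iff_norm.1 hw)
    exact mul_le_of_le_one_left (norm_nonneg _) hτ.2.le

/-- The usual chain rule fails, since `u` is merely continuous in `D(A^{1/2})`. The remainder of `Π`
is `o(‖u(s) - u(t)‖_H)`, and this increment is `O(s - t)` because `u` is differentiable in `H`. -/
theorem IsPath.hasDerivWithinAt_potential (hF1 : HypF1 F) (hF2 : HypF2 F Fstar Pi0 Pi1)
    (hp : IsPath J u v) {t : ℝ} (ht : t ∈ J) :
    HasDerivWithinAt (fun s => Pi0 (u s) + Pi1 (u s)) (inner ℝ (F (u t) - Fstar (u t)) (v t)) J t := by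
  have hd := hp.hasDeriv t ht
  have h1 := (hF2.isLittleO hF1 (u t)).comp_tendsto (hp.continuousOn t ht)
  have h2 : HasDerivWithinAt (fun s => Pi0 (u s) + Pi1 (u s) -
      inner ℝ (F (u t) - Fstar (u t)) (A.incl (u s))) 0 J t := by
    rw [hasDerivWithinAt_iff_isLittleO]
    have hO : (fun s => A.incl (u s) - A.incl (u t)) =O[𝓝[J] t] fun s => s - t :=
      hd.isBigO_sub.comp_tendsto (tendsto_id.prodMk tendsto_const_pure)
    simp only [Function.comp_def, map_sub] at h1
    refine (h1.trans_isBigO hO).congr_left fun s => ?_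
    simp only [inner_sub_right, smul_zero, sub_zero]
    ring
  have h4 : HasDerivWithinAt (fun s => (inner ℝ (F (u t) - Fstar (u t)) (A.incl (u s)) : ℝ))
      (inner ℝ (F (u t) - Fstar (u t)) (v t)) J t :=
    (innerSL ℝ (F (u t) - Fstar (u t))).hasFDerivAt.comp_hasDerivWithinAt t hd
  refine ((h2.add h4).congr_deriv (zero_add _)).congr_of_eventuallyEq_of_mem
    (Eventually.of_forall fun s => ?_) ht
  simp

/-- The linear energy identity with forcing `-F(u) - M(u_t)` is added to the integrated derivative
of the potential. The power of `F` cancels, leaving those of `F*`, the damping and the delay term.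
-/
theorem IsMildSolution.energy_eq (hh : 0 < h) (hF1 : HypF1 F) (hF2 : HypF2 F Fstar Pi0 Pi1)
    (hM1 : HypM1 M) (hJ : IsTimeInterval h J) (hu : IsMildSolution (waveGroup A k) F M J φ u)
    {t : ℝ} (ht : t ∈ J) (ht0 : 0 ≤ t) :
    energy Pi0 Pi1 (u t) (velocity J u t) + k * ∫ s in (0 : ℝ)..t, ‖velocity J u s‖ ^ 2 =
      energy Pi0 Pi1 (u 0) (velocity J u 0)
        - (∫ s in (0 : ℝ)..t, inner ℝ (Fstar (u s)) (velocity J u s))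
        - ∫ s in (0 : ℝ)..t, inner ℝ (delayTerm M u s) (velocity J u s) := by
  obtain ⟨f, hf, hfu, hU⟩ := hu.exists_forcing hh hJ hF1.continuous hM1 ht ht0
  have hp := hu.isPath hh hJ
  set v := velocity J u with hv
  have hsub : Icc 0 t ⊆ J := fun s hs => hJ.mem hh ht (by linarith [hs.1]) hs.2
  have hcu := hp.continuousOn.mono hsub
  have hcv := hp.continuousOn_vel.mono hsub
  have hcF : ContinuousOn (fun s => F (u s)) (Icc 0 t) := hF1.continuous.comp_continuousOn hcu
  have hcFs : ContinuousOn (fun s => Fstar (u s)) (Icc 0 t) :=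
    hF2.continuous_Fstar.comp_continuousOn hcu
  have hcD : ContinuousOn (delayTerm M u) (Icc 0 t) := hp.continuousOn_evalHistory hh hJ hM1 ht
  have hck : ContinuousOn (fun s => -(k * ‖v s‖ ^ 2)) (Icc 0 t) :=
    (continuousOn_const.mul (hcv.norm.pow 2)).neg
  have hI := fun {g : ℝ → ℝ} => intervalIntegrable_of_continuousOn_Icc (g := g) ht0
  have h1 := energy_forcedFlow (A := A) (k := k) (U₀ := (u 0, v 0)) hf t
  rw [← hU t ⟨ht0, le_rfl⟩] at h1
  have h2 : ∫ s in (0 : ℝ)..t, (-(k * ‖(forcedFlow A k (u 0, v 0) f s).2‖ ^ 2) +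
        inner ℝ (f s) (forcedFlow A k (u 0, v 0) f s).2) =
      ∫ s in (0 : ℝ)..t, (-(k * ‖v s‖ ^ 2) - inner ℝ (F (u s)) (v s)
        - inner ℝ (delayTerm M u s) (v s)) := by
    refine intervalIntegral.integral_congr fun s hs => ?_
    rw [uIcc_of_le ht0] at hs
    rw [← hU s hs, hfu s hs, inner_sub_left, inner_neg_left]
    ring
  have h3 := intervalIntegral.integral_eq_sub_of_hasDerivAt_of_le ht0
    (f := fun s => Pi0 (u s) + Pi1 (u s))
    (f' := fun s => inner ℝ (F (u s)) (v s) - inner ℝ (Fstar (u s)) (v s)) (fun s hs =>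
      ((hp.hasDerivWithinAt_potential hF1 hF2 (hsub hs)).mono hsub).continuousWithinAt)
    (fun s hs => by
      have := (hp.hasDerivWithinAt_potential hF1 hF2 (hsub ⟨hs.1.le, hs.2.le⟩)).mono hsub
      rw [inner_sub_left] at this
      exact this.hasDerivAt (Icc_mem_nhds hs.1 hs.2))
    (hI ((hcF.inner hcv).sub (hcFs.inner hcv)))
  rw [intervalIntegral.integral_sub (hI (hcF.inner hcv)) (hI (hcFs.inner hcv))] at h3
  rw [integral_sub_sub_of_continuousOn ht0 hck (hcF.inner hcv) (hcD.inner hcv),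
    intervalIntegral.integral_neg, intervalIntegral.integral_const_mul] at h2
  rw [h2] at h1
  simp only [energy, ← A.norm_DHalf]
  linarith

end Energy

/-! ### Gronwall's inequality with delay -/

/-- With `q` the maximum of `y(s) e^{-ls}`, the hypothesis at a maximum point `m` reads `q e^{lm} ≤
a + (q/2) e^{lm}`, whence `q ≤ 2a`. The hypothesis allows a bound on the whole past of `y`, which is
the form needed for delay terms. -/
theorem le_of_forall_exp_bound {y : ℝ → ℝ} {T a l : ℝ} (hl : 0 ≤ l)
    (hy : ContinuousOn y (Icc 0 T)) (hy0 : ∀ t ∈ Icc 0 T, 0 ≤ y t)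
    (hyp : ∀ t ∈ Icc 0 T, ∀ q, 0 ≤ q → (∀ s ∈ Icc 0 t, y s ≤ q * Real.exp (l * s)) →
      y t ≤ a + q / 2 * Real.exp (l * t)) {t : ℝ} (ht : t ∈ Icc 0 T) :
    y t ≤ 2 * a * Real.exp (l * t) := by
  obtain ⟨m, hm, hmax⟩ := isCompact_Icc.exists_isMaxOn ⟨t, ht⟩
    (f := fun s => y s * Real.exp (-(l * s))) (hy.mul (by fun_prop))
  set q := y m * Real.exp (-(l * m)) with hq
  have hyq : ∀ s ∈ Icc 0 T, y s ≤ q * Real.exp (l * s) := by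
    intro s hs
    have h1 : y s * Real.exp (-(l * s)) ≤ q := hmax hs
    calc y s = y s * Real.exp (-(l * s)) * Real.exp (l * s) := by
          rw [mul_assoc, ← Real.exp_add]; simp
      _ ≤ _ := by gcongr
  have hq0 : 0 ≤ q := mul_nonneg (hy0 m hm) (Real.exp_pos _).le
  have h1 := hyp m hm q hq0 fun s hs => hyq s ⟨hs.1, hs.2.trans hm.2⟩
  have h2 : y m = q * Real.exp (l * m) := by
    rw [hq, mul_assoc, ← Real.exp_add]; simp
  have h3 : q ≤ q * Real.exp (l * m) :=
    le_mul_of_one_le_right hq0 (Real.one_le_exp (mul_nonneg hl hm.1))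
  refine (hyq t ht).trans ?_
  gcongr
  linarith

/-- Integrating `e^{ls}` gains the factor `1/l`; a large `l` supplies the smallness used by the
Gronwall and contraction arguments. -/
theorem intervalIntegral_le_of_exp_bound {g : ℝ → ℝ} {t a b l : ℝ} (ht : 0 ≤ t) (hl : 0 < l)
    (hb : 0 ≤ b) (hg : ContinuousOn g (Icc 0 t))
    (hle : ∀ s ∈ Icc 0 t, g s ≤ a + b * Real.exp (l * s)) :
    ∫ s in (0 : ℝ)..t, g s ≤ a * t + b / l * Real.exp (l * t) := by
  have hc : Continuous fun s => a + b * Real.exp (l * s) := by fun_prop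
  have h1 : ∫ s in (0 : ℝ)..t, g s ≤ ∫ s in (0 : ℝ)..t, (a + b * Real.exp (l * s)) := by
    refine intervalIntegral.integral_mono_on ht ?_ (hc.intervalIntegrable _ _) hle
    rw [← uIcc_of_le ht] at hg
    exact hg.intervalIntegrable
  have h2 := intervalIntegral.integral_eq_sub_of_hasDerivAt (a := 0) (b := t)
    (f := fun s => a * s + b / l * Real.exp (l * s)) (f' := fun s => a + b * Real.exp (l * s))
    (fun s _ => by
      have := ((hasDerivAt_id s).const_mul a).add
        ((((hasDerivAt_id s).const_mul l).exp).const_mul (b / l))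
      refine this.congr_deriv ?_
      simp only [id, mul_one]
      field_simp) (hc.intervalIntegrable _ _)
  rw [h2] at h1
  have h3 : 0 ≤ b / l := by positivity
  simp only [mul_zero, Real.exp_zero, mul_one, zero_add] at h1
  linarith

/-! ### A priori bounds and continuous dependence -/

/-- An estimate of the power of the non-conservative forces. -/
theorem power_le {H : Type*} [NormedAddCommGroup H] [InnerProductSpace ℝ H] {w d z : H}
    {k f₀ c M₀ M₁ ρ r : ℝ} (hf₀ : 0 ≤ f₀) (hc : 0 ≤ c) (hM₁ : 0 ≤ M₁) (hw : ‖w‖ ≤ f₀ + c * r) (hd : ‖d‖ ≤ M₀ + M₁ * (ρ + r + (ρ + r)))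
    (hz : ‖z‖ ≤ r) :
    -(k * ‖z‖ ^ 2) - inner ℝ w z - inner ℝ d z ≤
      f₀ ^ 2 + M₀ ^ 2 + M₁ * ρ ^ 2 + (|k| + 2 + c + 3 * M₁) * r ^ 2 := by
  have hr : 0 ≤ r := (norm_nonneg _).trans hz
  have hi1 : -inner ℝ w z ≤ (f₀ + c * r) * r :=
    (neg_le_abs _).trans ((abs_real_inner_le_norm _ _).trans
      (mul_le_mul hw hz (norm_nonneg _) (by positivity)))
  have hi2 : -inner ℝ d z ≤ (M₀ + M₁ * (ρ + r + (ρ + r))) * r :=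
    (neg_le_abs _).trans ((abs_real_inner_le_norm _ _).trans
      (mul_le_mul hd hz (norm_nonneg _) ((norm_nonneg _).trans hd)))
  have hi3 : -(k * ‖z‖ ^ 2) ≤ |k| * r ^ 2 := by
    rw [← neg_mul]
    exact mul_le_mul (neg_le_abs k) (by gcongr) (sq_nonneg _) (abs_nonneg _)
  have hj1 : f₀ * r ≤ f₀ ^ 2 + r ^ 2 := by nlinarith [sq_nonneg (f₀ - r)]
  have hj2 : M₀ * r ≤ M₀ ^ 2 + r ^ 2 := by nlinarith [sq_nonneg (M₀ - r)]
  have hj3 : M₁ * (2 * ρ * r) ≤ M₁ * (ρ ^ 2 + r ^ 2) :=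
    mul_le_mul_of_nonneg_left (by nlinarith [sq_nonneg (ρ - r)]) hM₁
  linarith

section Bounds

variable {H : Type*} [NormedAddCommGroup H] [InnerProductSpace ℝ H] [CompleteSpace H]
variable {A : PosDiscreteOp H} {h k : ℝ} {F Fstar : A.DHalf → H} {Pi0 Pi1 : A.DHalf → ℝ}
variable {M : W A h → H}

theorem IsMildSolution.norm_initial_le {S : ℝ → A.Y →L[ℝ] A.Y} {J : Set ℝ} {φ : W A h}
    {u : ℝ → A.DHalf} (hu : IsMildSolution S F M J φ u) {s : ℝ} (hs : s ∈ Icc (-h) 0) :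
    ‖u s‖ ≤ normW φ := by
  rw [hu.initial ⟨s, hs⟩]; exact norm_le_normW φ _

theorem IsMildSolution.norm_velocity_initial_le {S : ℝ → A.Y →L[ℝ] A.Y} {J : Set ℝ} {φ : W A h}
    {u : ℝ → A.DHalf} (hh : 0 < h) (hJ : IsTimeInterval h J) (hu : IsMildSolution S F M J φ u)
    {s : ℝ} (hs : s ∈ Icc (-h) 0) : ‖velocity J u s‖ ≤ normW φ := by
  rw [hu.velocity_initial hh hJ ⟨s, hs⟩]; exact norm_dot_le_normW hh φ _

/-- Mild solutions are bounded on bounded time intervals, uniformly for bounded initial data. -/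
theorem exists_bound_of_isMildSolution (hh : 0 < h) (hF1 : HypF1 F) (hF2 : HypF2 F Fstar Pi0 Pi1)
    (hM1 : HypM1 M) (hM2 : HypM2 M) {ρ : ℝ} (hρ : 0 < ρ) (T : ℝ) :
    ∃ R, ρ ≤ R ∧ ∀ J : Set ℝ, IsTimeInterval h J → ∀ (φ : W A h) (u : ℝ → A.DHalf), normW φ ≤ ρ →
      IsMildSolution (waveGroup A k) F M J φ u → ∀ t ∈ J, t ≤ T →
        ‖u t‖ ≤ R ∧ ‖velocity J u t‖ ≤ R := by
  obtain ⟨c, hc0, hFs⟩ := hF2.exists_norm_Fstar_le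
  obtain ⟨M₀, M₁, hM₀, hM₁, hM⟩ := hM2
  obtain ⟨B, hB⟩ := hF2.bounded ρ hρ
  -- With `η = 1/4` the energy still controls `(‖u‖² + ‖v‖²)/4 - C`, as the remaining multiple of
  -- `Π₀` is nonnegative.
  obtain ⟨C, hC, hdom⟩ := hF2.dominated (1 / 4) (by norm_num)
  set f₀ := ‖Fstar 0‖ with hf₀
  have hf0 : 0 ≤ f₀ := norm_nonneg _
  set b := |k| + 2 + c + 3 * M₁ with hb
  have hb0 : 0 < b := by positivity
  set a₁ := f₀ ^ 2 + M₀ ^ 2 + M₁ * ρ ^ 2 with ha₁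
  have ha₁0 : 0 ≤ a₁ := by positivity
  -- `E₀` bounds the initial energy and `a₁ + b r²` the power of the forces. The factor 4 in `a`
  -- undoes the coercivity constant, and `l = 8b` turns `4bq/l` into `q/2`.
  set E₀ := ρ ^ 2 + B + 1 / 4 * (ρ ^ 2 + B) + C with hE₀
  set a := 4 * (E₀ + C + a₁ * T) with ha
  set l := 8 * b with hl
  have hl0 : 0 < l := by positivity
  set R := max ρ (√(2 * a * Real.exp (l * T))) with hR
  refine ⟨R, le_max_left _ _, fun J hJ φ u hφ hu t ht htT => ?_⟩
  have hp := hu.isPath hh hJ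
  set v := velocity J u with hv
  have hini : ∀ s ∈ Icc (-h) 0, ‖u s‖ ≤ ρ ∧ ‖v s‖ ≤ ρ := fun s hs =>
    ⟨(hu.norm_initial_le hs).trans hφ, (hu.norm_velocity_initial_le hh hJ hs).trans hφ⟩
  rcases le_or_gt t 0 with ht0 | ht0
  · have hth : -h ≤ t := hJ.2.2 ht
    exact ⟨(hini t ⟨hth, ht0⟩).1.trans (le_max_left _ _),
      (hini t ⟨hth, ht0⟩).2.trans (le_max_left _ _)⟩
  have hsub : Icc 0 t ⊆ J := fun s hs => hJ.mem hh ht (by linarith [hs.1]) hs.2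
  have h00 : (0 : ℝ) ∈ Icc (-h) 0 := ⟨by linarith, le_rfl⟩
  have hcu := hp.continuousOn.mono hsub
  have hcv := hp.continuousOn_vel.mono hsub
  have hcFs : ContinuousOn (fun s => Fstar (u s)) (Icc 0 t) :=
    hF2.continuous_Fstar.comp_continuousOn hcu
  have hcD : ContinuousOn (delayTerm M u) (Icc 0 t) := hp.continuousOn_evalHistory hh hJ hM1 ht
  have hyt := le_of_forall_exp_bound (y := fun s => ‖u s‖ ^ 2 + ‖v s‖ ^ 2) (T := t) (a := a)
    hl0.le ((hcu.norm.pow 2).add (hcv.norm.pow 2)) (fun s _ => by positivity)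
    (fun r hr q hq hyq => ?_) (t := t) ⟨ht0.le, le_rfl⟩
  · have hexp : 2 * a * Real.exp (l * t) ≤ 2 * a * Real.exp (l * T) := by
      -- The constant `B` comes without a sign; nonnegativity of `a` is read off the estimate
      -- itself.
      have ha0 : 0 ≤ 2 * a := by
        have h1 : 0 ≤ 2 * a * Real.exp (l * t) := le_trans (by positivity) hyt
        exact nonneg_of_mul_nonneg_left h1 (Real.exp_pos _)
      gcongr
    refine ⟨le_max_of_le_right (Real.le_sqrt_of_sq_le ?_),
      le_max_of_le_right (Real.le_sqrt_of_sq_le ?_)⟩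
    · exact (le_add_of_nonneg_right (sq_nonneg _)).trans (hyt.trans hexp)
    · exact (le_add_of_nonneg_left (sq_nonneg _)).trans (hyt.trans hexp)
  · have hrJ : r ∈ J := hsub hr
    have hsubr : Icc 0 r ⊆ Icc 0 t := Icc_subset_Icc_right hr.2
    have hen := hu.energy_eq hh hF1 hF2 hM1 hJ hrJ hr.1
    rw [← hv] at hen
    have hck : ContinuousOn (fun s => -(k * ‖v s‖ ^ 2)) (Icc 0 t) :=
      (continuousOn_const.mul (hcv.norm.pow 2)).neg
    have hcg : ContinuousOn (fun s => -(k * ‖v s‖ ^ 2) - inner ℝ (Fstar (u s)) (v s) -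
        inner ℝ (delayTerm M u s) (v s)) (Icc 0 t) :=
      (hck.sub (hcFs.inner hcv)).sub (hcD.inner hcv)
    have hsplit : ∫ s in (0 : ℝ)..r, (-(k * ‖v s‖ ^ 2) - inner ℝ (Fstar (u s)) (v s) -
        inner ℝ (delayTerm M u s) (v s)) = -(k * ∫ s in (0 : ℝ)..r, ‖v s‖ ^ 2) -
        (∫ s in (0 : ℝ)..r, inner ℝ (Fstar (u s)) (v s)) -
        ∫ s in (0 : ℝ)..r, inner ℝ (delayTerm M u s) (v s) := by
      rw [integral_sub_sub_of_continuousOn hr.1 (hck.mono hsubr) ((hcFs.inner hcv).mono hsubr)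
          ((hcD.inner hcv).mono hsubr), intervalIntegral.integral_neg,
        intervalIntegral.integral_const_mul]
    have hint := intervalIntegral_le_of_exp_bound (a := a₁) (b := b * q) hr.1 hl0 (by positivity)
      (hcg.mono hsubr) fun s hs => ?_
    · rw [hsplit] at hint
      simp only [energy, ← A.norm_DHalf] at hen
      have h1 := hdom (u r)
      have h2 := hdom (u 0)
      have h3 := hB (u 0) (hini 0 h00).1
      have h4 := hF2.nonneg (u r)
      have h5 : ‖u 0‖ ^ 2 ≤ ρ ^ 2 := by
        have := (hini 0 h00).1
        gcongr
      have h6 : ‖v 0‖ ^ 2 ≤ ρ ^ 2 := by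
        have := (hini 0 h00).2
        gcongr
      have h7 : b * q / l = q / 8 := by rw [hl]; field_simp
      rw [h7] at hint
      have h8 : a₁ * r ≤ a₁ * T := by
        have := hr.2.trans htT
        gcongr
      have h9 := (abs_le.1 h1).1
      have h10 := (abs_le.1 h2).2
      rw [ha, hE₀]
      linarith [sq_nonneg ‖v r‖]
    · have hs' := hsubr hs
      have hsJ : s ∈ J := hsub hs'
      -- Since the exponential weight increases, `r₁` bounds position and velocity on all of
      -- `[0,s]`; together with the initial data, `ρ + r₁` bounds them on the history.
      set r₁ := √(q * Real.exp (l * s)) with hr₁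
      have hq1 : 0 ≤ q * Real.exp (l * s) := by positivity
      have hr₁0 : 0 ≤ r₁ := Real.sqrt_nonneg _
      have hr₁sq : r₁ ^ 2 = q * Real.exp (l * s) := Real.sq_sqrt hq1
      have hbd : ∀ τ ∈ Icc 0 s, ‖u τ‖ ≤ r₁ ∧ ‖v τ‖ ≤ r₁ := by
        intro τ hτ
        have h1 : ‖u τ‖ ^ 2 + ‖v τ‖ ^ 2 ≤ q * Real.exp (l * s) := by
          refine (hyq τ ⟨hτ.1, hτ.2.trans hs.2⟩).trans ?_
          have := hτ.2
          gcongr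
        exact ⟨Real.le_sqrt_of_sq_le (by linarith [sq_nonneg ‖v τ‖]),
          Real.le_sqrt_of_sq_le (by linarith [sq_nonneg ‖u τ‖])⟩
      have hbd' : ∀ τ ∈ Icc (-h) s, ‖u τ‖ ≤ ρ + r₁ ∧ ‖v τ‖ ≤ ρ + r₁ := by
        intro τ hτ
        rcases le_total τ 0 with h0 | h0
        · have := hini τ ⟨hτ.1, h0⟩
          exact ⟨by linarith [this.1], by linarith [this.2]⟩
        · have := hbd τ ⟨h0, hτ.2⟩
          exact ⟨by linarith [this.1], by linarith [this.2]⟩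
      have hm := hp.history_mem hh hJ hsJ hs.1
      have hD : ‖delayTerm M u s‖ ≤ M₀ + M₁ * (ρ + r₁ + (ρ + r₁)) := by
        rw [delayTerm_eq M hm]
        refine (hM _).trans ?_
        have := hp.normW_history_le hh hJ hsJ hs.1 hm (fun τ hτ => (hbd' τ hτ).1)
          fun τ hτ => (hbd' τ hτ).2
        gcongr
      obtain ⟨hus, hvs⟩ := hbd s ⟨hs.1, le_rfl⟩
      have hw : ‖Fstar (u s)‖ ≤ f₀ + c * r₁ :=
        (hFs (u s)).trans (add_le_add_right (mul_le_mul_of_nonneg_left hus hc0) f₀)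
      rw [mul_assoc, ← hr₁sq]
      exact power_le hf0 hc0 hM₁ hw hD hvs

/-- Mild solutions depend Lipschitz continuously on the initial data. -/
theorem exists_lipschitz_of_isMildSolution (hh : 0 < h) (hF1 : HypF1 F)
    (hF2 : HypF2 F Fstar Pi0 Pi1) (hM1 : HypM1 M) (hM2 : HypM2 M) {ρ T : ℝ} (hρ : 0 < ρ)
    (hT : 0 < T) :
    ∃ C : ℝ, ∀ J : Set ℝ, IsTimeInterval h J →
      ∀ (φ₁ φ₂ : W A h) (u₁ u₂ : ℝ → A.DHalf), normW φ₁ ≤ ρ → normW φ₂ ≤ ρ →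
        IsMildSolution (waveGroup A k) F M J φ₁ u₁ → IsMildSolution (waveGroup A k) F M J φ₂ u₂ →
        ∀ t ∈ J, 0 ≤ t → t ≤ T →
          ‖u₁ t - u₂ t‖ + ‖velocity J u₁ t - velocity J u₂ t‖ ≤ C * distW φ₁ φ₂ := by
  obtain ⟨R, hρR, hR⟩ := exists_bound_of_isMildSolution (k := k) hh hF1 hF2 hM1 hM2 hρ T
  have hR0 : 0 < R := hρ.trans_le hρR
  obtain ⟨L, hL⟩ := hF1 R hR0
  obtain ⟨N, hN⟩ := hM1 (R + R) (by linarith)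
  set K := 2 * Real.exp (|k| * T) with hK
  have hK0 : 0 < K := by positivity
  set b := |L| + 2 * |N| with hb
  have hb0 : 0 ≤ b := by positivity
  -- Chosen so that `K b / l ≤ 1/4`; the sum of the two component norms is at most twice the norm in
  -- `Y`, which yields the required `1/2`. The added 1 keeps `l` positive when `b = 0`.
  set l := 4 * K * b + 1 with hl
  have hl0 : 0 < l := by positivity
  refine ⟨2 * (2 * K * (1 + 2 * |N| * T)) * Real.exp (l * T),
    fun J hJ φ₁ φ₂ u₁ u₂ hφ₁ hφ₂ hu₁ hu₂ t ht ht0 htT => ?_⟩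
  set D := distW φ₁ φ₂ with hD
  have hD0 : 0 ≤ D := distW_nonneg _ _
  have hp₁ := hu₁.isPath hh hJ
  have hp₂ := hu₂.isPath hh hJ
  have hR₁ := hR J hJ φ₁ u₁ hφ₁ hu₁
  have hR₂ := hR J hJ φ₂ u₂ hφ₂ hu₂
  set v₁ := velocity J u₁ with hv₁
  set v₂ := velocity J u₂ with hv₂
  obtain ⟨f₁, hf₁, hfu₁, hU₁⟩ := hu₁.exists_forcing hh hJ hF1.continuous hM1 ht ht0
  obtain ⟨f₂, hf₂, hfu₂, hU₂⟩ := hu₂.exists_forcing hh hJ hF1.continuous hM1 ht ht0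
  have hini : ∀ s ∈ Icc (-h) 0, ‖u₁ s - u₂ s‖ ≤ D ∧ ‖v₁ s - v₂ s‖ ≤ D := by
    intro s hs
    constructor
    · rw [hu₁.initial ⟨s, hs⟩, hu₂.initial ⟨s, hs⟩]; exact norm_sub_le_distW _ _ _
    · rw [hv₁, hv₂, hu₁.velocity_initial hh hJ ⟨s, hs⟩, hu₂.velocity_initial hh hJ ⟨s, hs⟩]
      exact norm_dot_sub_le_distW hh _ _ _
  have h00 : (0 : ℝ) ∈ Icc (-h) 0 := ⟨by linarith, le_rfl⟩
  have hsub : Icc 0 t ⊆ J := fun s hs => hJ.mem hh ht (by linarith [hs.1]) hs.2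
  have hyt := le_of_forall_exp_bound (y := fun s => ‖u₁ s - u₂ s‖ + ‖v₁ s - v₂ s‖) (T := t)
    (a := 2 * K * (1 + 2 * |N| * T) * D) hl0.le
    (((hp₁.continuousOn.sub hp₂.continuousOn).mono hsub).norm.add
      ((hp₁.continuousOn_vel.sub hp₂.continuousOn_vel).mono hsub).norm)
    (fun s _ => by positivity) (fun r hr q hq hyq => ?_) (t := t) ⟨ht0, le_rfl⟩
  · refine hyt.trans ?_
    have : Real.exp (l * t) ≤ Real.exp (l * T) := by gcongr
    calc _ ≤ 2 * (2 * K * (1 + 2 * |N| * T) * D) * Real.exp (l * T) := by gcongr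
      _ = _ := by ring
  · have h1 := norm_forcedFlow_sub_le (A := A) (k := k) (U₀ := (u₁ 0, v₁ 0)) (V₀ := (u₂ 0, v₂ 0))
      hf₁ hf₂ hr.1 (hr.2.trans htT)
    rw [← hU₁ r hr, ← hU₂ r hr, ← hK] at h1
    have h2 : ‖((u₁ 0, v₁ 0) - (u₂ 0, v₂ 0) : A.Y)‖ ≤ D :=
      norm_prod_le_iff.2 (hini 0 h00)
    have h3 := intervalIntegral_le_of_exp_bound (g := fun s => ‖f₁ s - f₂ s‖) (a := 2 * |N| * D)
      (b := b * q) hr.1 hl0 (by positivity) (by fun_prop) fun s hs => ?_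
    · have h4 := norm_prod_le_iff.1 (le_refl ‖((u₁ r, v₁ r) - (u₂ r, v₂ r) : A.Y)‖)
      have h5 : K * (b * q / l) ≤ q / 4 := by
        rw [← mul_div_assoc, div_le_iff₀ hl0, hl]
        nlinarith
      have h6 : 2 * |N| * D * r ≤ 2 * |N| * D * T := by
        have := hr.2.trans htT
        gcongr
      have h7 := mul_le_mul_of_nonneg_right h5 (Real.exp_pos (l * r)).le
      have h8 : ‖((u₁ r, v₁ r) - (u₂ r, v₂ r) : A.Y)‖ ≤
          K * (D + (2 * |N| * D * T + b * q / l * Real.exp (l * r))) := by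
        refine h1.trans ?_
        gcongr
        linarith
      simp only [Prod.fst_sub, Prod.snd_sub] at h4
      linarith [h4.1, h4.2]
    · have hsr : s ∈ Icc 0 t := ⟨hs.1, hs.2.trans hr.2⟩
      have hsJ : s ∈ J := hsub hsr
      have hsT : s ≤ T := hsr.2.trans htT
      have hm₁ := hp₁.history_mem hh hJ hsJ hs.1
      have hm₂ := hp₂.history_mem hh hJ hsJ hs.1
      have hmono : ∀ τ ∈ Icc 0 s, ‖u₁ τ - u₂ τ‖ + ‖v₁ τ - v₂ τ‖ ≤ q * Real.exp (l * s) := by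
        intro τ hτ
        refine (hyq τ ⟨hτ.1, hτ.2.trans hs.2⟩).trans ?_
        have := hτ.2
        gcongr
      have hbd : ∀ τ ∈ Icc (-h) s, ‖u₁ τ - u₂ τ‖ ≤ D + q * Real.exp (l * s) ∧
          ‖v₁ τ - v₂ τ‖ ≤ D + q * Real.exp (l * s) := by
        intro τ hτ
        have hq1 : 0 ≤ q * Real.exp (l * s) := by positivity
        rcases le_total τ 0 with h0 | h0
        · have := hini τ ⟨hτ.1, h0⟩
          exact ⟨by linarith [this.1], by linarith [this.2]⟩
        · have := hmono τ ⟨h0, hτ.2⟩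
          have hn1 := norm_nonneg (u₁ τ - u₂ τ)
          have hn2 := norm_nonneg (v₁ τ - v₂ τ)
          exact ⟨by linarith, by linarith⟩
      have hθ : ∀ θ ∈ Icc (-h) 0, s + θ ∈ Icc (-h) s := fun θ hθ =>
        ⟨by linarith [hθ.1, hs.1], by linarith [hθ.2]⟩
      have hdist := IsPath.distW_history_le hh hJ hp₁ hp₂ hsJ hs.1 hsJ hs.1 hm₁ hm₂
        (fun θ h => (hbd _ (hθ θ h)).1) fun θ h => (hbd _ (hθ θ h)).2
      have hT' : ∀ τ ∈ Icc (-h) s, τ ∈ J ∧ τ ≤ T := fun τ hτ =>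
        ⟨hJ.mem hh hsJ hτ.1 hτ.2, hτ.2.trans hsT⟩
      have hn₁ := hp₁.normW_history_le hh hJ hsJ hs.1 hm₁
        (fun τ hτ => (hR₁ τ (hT' τ hτ).1 (hT' τ hτ).2).1)
        fun τ hτ => (hR₁ τ (hT' τ hτ).1 (hT' τ hτ).2).2
      have hn₂ := hp₂.normW_history_le hh hJ hsJ hs.1 hm₂
        (fun τ hτ => (hR₂ τ (hT' τ hτ).1 (hT' τ hτ).2).1)
        fun τ hτ => (hR₂ τ (hT' τ hτ).1 (hT' τ hτ).2).2
      have hMd : ‖delayTerm M u₁ s - delayTerm M u₂ s‖ ≤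
          |N| * (D + q * Real.exp (l * s) + (D + q * Real.exp (l * s))) := by
        rw [delayTerm_eq M hm₁, delayTerm_eq M hm₂]
        refine (hN _ _ hn₁ hn₂).trans ?_
        exact mul_le_mul (le_abs_self N) hdist (distW_nonneg _ _) (abs_nonneg N)
      have hFd : ‖F (u₁ s) - F (u₂ s)‖ ≤ |L| * (q * Real.exp (l * s)) := by
        refine (hL _ _ (hR₁ s hsJ hsT).1 (hR₂ s hsJ hsT).1).trans ?_
        have := hmono s ⟨hs.1, le_rfl⟩
        exact mul_le_mul (le_abs_self L) (by linarith [norm_nonneg (v₁ s - v₂ s)])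
          (norm_nonneg _) (abs_nonneg L)
      have heq : f₁ s - f₂ s =
          -(F (u₁ s) - F (u₂ s)) - (delayTerm M u₁ s - delayTerm M u₂ s) := by
        rw [hfu₁ s hsr, hfu₂ s hsr]; abel
      rw [heq]
      refine (norm_sub_le _ _).trans ?_
      rw [norm_neg, hb]
      linarith

/-- Uniqueness of mild solutions. -/
theorem IsMildSolution.eqOn (hh : 0 < h) (hF1 : HypF1 F)
    (hF2 : HypF2 F Fstar Pi0 Pi1) (hM1 : HypM1 M) (hM2 : HypM2 M) {J : Set ℝ}
    (hJ : IsTimeInterval h J) {φ : W A h} {u₁ u₂ : ℝ → A.DHalf}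
    (hu₁ : IsMildSolution (waveGroup A k) F M J φ u₁)
    (hu₂ : IsMildSolution (waveGroup A k) F M J φ u₂) : EqOn u₁ u₂ J := by
  intro t ht
  rcases le_total t 0 with ht0 | ht0
  · have hm : t ∈ Icc (-h) 0 := ⟨hJ.2.2 ht, ht0⟩
    rw [hu₁.initial ⟨t, hm⟩, hu₂.initial ⟨t, hm⟩]
  -- The additions of 1 here and to `t` only supply the strict positivity demanded of the radius and
  -- the time.
  · have hρ : 0 < normW φ + 1 := by linarith [normW_nonneg φ]
    obtain ⟨C, hC⟩ := exists_lipschitz_of_isMildSolution (k := k) hh hF1 hF2 hM1 hM2 hρ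
      (T := t + 1) (by linarith)
    have := hC J hJ φ φ u₁ u₂ (by linarith) (by linarith) hu₁ hu₂ t ht ht0 (by linarith)
    rw [distW_self, mul_zero] at this
    refine sub_eq_zero.1 (norm_le_zero_iff.1 ?_)
    linarith [norm_nonneg (velocity J u₁ t - velocity J u₂ t)]

end Bounds

/-! ### Existence for globally Lipschitz delay terms -/

/-- The forcing obtained from a continuous function on `[0,T]` through exponential weighting. -/
def weighted {H : Type*} [NormedAddCommGroup H] [NormedSpace ℝ H] {T : ℝ} (hT : 0 ≤ T) (l : ℝ) (g : C(Icc 0 T, H)) (s : ℝ) : H :=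
  Real.exp (l * s) • g (projIcc 0 T hT s)

theorem continuous_weighted {H : Type*} [NormedAddCommGroup H] [NormedSpace ℝ H] {T : ℝ} (hT : 0 ≤ T) (l : ℝ) (g : C(Icc 0 T, H)) :
    Continuous (weighted hT l g) :=
  (by fun_prop : Continuous fun s : ℝ => Real.exp (l * s)).smul
    (g.continuous.comp continuous_projIcc)

section Existence

variable {H : Type*} [NormedAddCommGroup H] [InnerProductSpace ℝ H] [CompleteSpace H]
variable {A : PosDiscreteOp H} {h k : ℝ}

theorem zero_mem_Icc_delay (hh : 0 < h) : (0 : ℝ) ∈ Icc (-h) 0 := ⟨by linarith, le_rfl⟩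

/-- The initial function up to time `0`, followed by a trajectory in `Y`: position. -/
def concatPos (hh : 0 < h) (φ : W A h) (U : ℝ → A.Y) (t : ℝ) : A.DHalf :=
  if t ≤ 0 then φ.1 (projIcc (-h) 0 (by linarith) t) else (U t).1

/-- The initial function up to time `0`, followed by a trajectory in `Y`: velocity. -/
def concatVel (hh : 0 < h) (φ : W A h) (U : ℝ → A.Y) (t : ℝ) : H :=
  if t ≤ 0 then dot φ (projIcc (-h) 0 (by linarith) t) else (U t).2

/-- The state `(φ(0), φ̇(0))`. -/
def initialState (hh : 0 < h) (φ : W A h) : A.Y :=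
  (φ.1 ⟨0, zero_mem_Icc_delay hh⟩, dot φ ⟨0, zero_mem_Icc_delay hh⟩)

theorem isTimeInterval_Icc (h : ℝ) {T : ℝ} (hT : 0 ≤ T) : IsTimeInterval h (Icc (-h) T) :=
  ⟨ordConnected_Icc, Icc_subset_Icc_right hT, Icc_subset_Ici_self⟩

theorem isTimeInterval_Ici (h : ℝ) : IsTimeInterval h (Ici (-h)) :=
  ⟨ordConnected_Ici, Icc_subset_Ici_self, Subset.rfl⟩

/-! ### Gluing an initial function to a trajectory -/

section Concat

variable {hh : 0 < h} {φ : W A h} {U : ℝ → A.Y}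

/-- At `t = 0` the definitions take the branch of the initial function; the matching condition makes
the two branches agree there. -/
theorem concat_of_nonneg (hU : U 0 = initialState hh φ) {t : ℝ} (ht : 0 ≤ t) :
    ((concatPos hh φ U t, concatVel hh φ U t) : A.Y) = U t := by
  rcases ht.eq_or_lt with rfl | ht
  · rw [hU, concatPos, concatVel, if_pos le_rfl, if_pos le_rfl, projIcc_right]; rfl
  · rw [concatPos, concatVel, if_neg ht.not_ge, if_neg ht.not_ge]

theorem concatPos_of_mem (θ : Icc (-h) 0) : concatPos hh φ U θ = φ.1 θ := by
  rw [concatPos, if_pos θ.2.2, projIcc_val]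

theorem concatVel_of_mem (θ : Icc (-h) 0) : concatVel hh φ U θ = dot φ θ := by
  rw [concatVel, if_pos θ.2.2, projIcc_val]

/-- Position and velocity both match at 0, so the one-sided derivatives from `[-h,0]` and `[0,∞)`
combine to a derivative within the union. Away from the closure of a piece the condition on it is
void. -/
theorem isPath_concat (hU : U 0 = initialState hh φ) (hUc : Continuous U)
    (hUd : ∀ t, HasDerivAt (fun t => A.incl (U t).1) (U t).2 t) :
    IsPath (Ici (-h)) (concatPos hh φ U) (concatVel hh φ U) := by
  have h0 : ∀ t : ℝ, t = 0 → projIcc (-h) 0 (by linarith) t = ⟨0, zero_mem_Icc_delay hh⟩ := by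
    rintro t rfl; exact projIcc_right _
  refine ⟨Continuous.continuousOn ?_, Continuous.continuousOn ?_, fun t ht => ?_⟩
  · refine Continuous.if_le (φ.2.1.comp continuous_projIcc) hUc.fst continuous_id continuous_const ?_
    intro t ht
    rw [h0 t ht, show t = 0 from ht, hU]; rfl
  · refine Continuous.if_le ((continuous_dot hh φ).comp continuous_projIcc) hUc.snd continuous_id
      continuous_const ?_
    intro t ht
    rw [h0 t ht, show t = 0 from ht, hU]; rfl
  · rw [← Icc_union_Ici_eq_Ici (show -h ≤ 0 by linarith)]
    refine HasDerivWithinAt.union ?_ ?_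
    · rcases le_or_gt t 0 with ht0 | ht0
      · have htm : t ∈ Icc (-h) 0 := ⟨ht, ht0⟩
        rw [concatVel_of_mem ⟨t, htm⟩]
        refine (hasDerivWithinAt_extendH φ ⟨t, htm⟩).congr (fun s hs => ?_) ?_
        · rw [extendH_apply φ.1 ⟨s, hs⟩, concatPos_of_mem ⟨s, hs⟩]
        · rw [extendH_apply φ.1 ⟨t, htm⟩, concatPos_of_mem ⟨t, htm⟩]
      · refine HasFDerivWithinAt.of_notMem_closure ?_
        rw [closure_Icc]
        exact fun hm => ht0.not_ge hm.2
    · have key : ∀ s, 0 ≤ s → concatPos hh φ U s = (U s).1 := fun s hs =>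
        congrArg Prod.fst (concat_of_nonneg hU hs)
      rcases le_or_gt 0 t with ht0 | ht0
      · rw [show concatVel hh φ U t = (U t).2 from congrArg Prod.snd (concat_of_nonneg hU ht0)]
        exact (hUd t).hasDerivWithinAt.congr (fun s hs => by rw [key s hs]) (by rw [key t ht0])
      · refine HasFDerivWithinAt.of_notMem_closure ?_
        rw [closure_Ici]
        exact fun hm => ht0.not_ge hm

theorem isPath_concat_forcedFlow {f : ℝ → H} (hf : Continuous f) :
    IsPath (Ici (-h)) (concatPos hh φ (forcedFlow A k (initialState hh φ) f))
      (concatVel hh φ (forcedFlow A k (initialState hh φ) f)) :=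
  isPath_concat forcedFlow_zero (continuous_forcedFlow hf) (hasDerivAt_incl_forcedFlow hf)

/-- Both trajectories follow the same initial function up to time 0, so their histories differ only
through `[0,t]`; position and velocity contribute `a` each. -/
theorem distW_history_concat_le {V : ℝ → A.Y} (hU : U 0 = initialState hh φ)
    (hV : V 0 = initialState hh φ)
    (hpU : IsPath (Ici (-h)) (concatPos hh φ U) (concatVel hh φ U))
    (hpV : IsPath (Ici (-h)) (concatPos hh φ V) (concatVel hh φ V)) {t : ℝ} (ht : 0 ≤ t)
    (hmU : history h (concatPos hh φ U) t ∈ W A h) (hmV : history h (concatPos hh φ V) t ∈ W A h)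
    {a : ℝ} (hle : ∀ s ∈ Icc 0 t, ‖U s - V s‖ ≤ a) :
    distW ⟨_, hmU⟩ ⟨_, hmV⟩ ≤ a + a := by
  have ha : 0 ≤ a := (norm_nonneg _).trans (hle t ⟨ht, le_rfl⟩)
  have htJ : t ∈ Ici (-h) := by simp only [mem_Ici]; linarith
  have key : ∀ θ ∈ Icc (-h) 0,
      ‖concatPos hh φ U (t + θ) - concatPos hh φ V (t + θ)‖ ≤ a ∧
      ‖concatVel hh φ U (t + θ) - concatVel hh φ V (t + θ)‖ ≤ a := by
    intro θ hθ
    rcases le_total (t + θ) 0 with h0 | h0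
    · have hm : t + θ ∈ Icc (-h) 0 := ⟨by linarith [hθ.1], h0⟩
      rw [concatPos_of_mem ⟨_, hm⟩, concatPos_of_mem ⟨_, hm⟩, concatVel_of_mem ⟨_, hm⟩,
        concatVel_of_mem ⟨_, hm⟩]
      simpa using ha
    · have h1 := hle (t + θ) ⟨h0, by linarith [hθ.2]⟩
      rw [← concat_of_nonneg hU h0, ← concat_of_nonneg hV h0] at h1
      exact norm_prod_le_iff.1 h1
  exact IsPath.distW_history_le hh (isTimeInterval_Ici h) hpU hpV htJ ht htJ ht hmU hmV
    (fun θ hθ => (key θ hθ).1) fun θ hθ => (key θ hθ).2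

end Concat

/-- The unknown of the fixed point problem is the weighted forcing `g = e^{-lt} f` in `C([0,T], H)`,
not the trajectory: any forcing yields, by Duhamel's formula, an admissible path, and the map
returns the force `-G(u_t)` along it. The nonlinearity `F` is set to zero, since it is later
absorbed into `G`. -/
theorem exists_isMildSolution_of_lipschitz (hh : 0 < h) {G : W A h → H} {K : ℝ} (hK : 0 ≤ K)
    (hG : ∀ φ ψ : W A h, ‖G φ - G ψ‖ ≤ K * distW φ ψ) (φ : W A h) {T : ℝ} (hT : 0 ≤ T) :
    ∃ u, IsMildSolution (waveGroup A k) (fun _ => 0) G (Icc (-h) T) φ u := by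
  set E := 2 * Real.exp (|k| * T) with hE
  have hE0 : 0 < E := by positivity
  -- The map has Lipschitz constant at most `2KE/l`, which this choice keeps below `1/2`; the 2
  -- counts position and velocity.
  set l := 4 * K * E + 1 with hl
  have hl0 : 0 < l := by positivity
  set U : C(Icc 0 T, H) → ℝ → A.Y := fun g =>
    forcedFlow A k (initialState hh φ) (weighted hT l g) with hU
  set u : C(Icc 0 T, H) → ℝ → A.DHalf := fun g => concatPos hh φ (U g) with hu
  have hp : ∀ g, IsPath (Ici (-h)) (u g) (concatVel hh φ (U g)) := fun g =>
    isPath_concat_forcedFlow (continuous_weighted hT l g)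
  have hJ := isTimeInterval_Ici h
  have hmem : ∀ g {t : ℝ}, 0 ≤ t → history h (u g) t ∈ W A h := fun g t ht =>
    (hp g).history_mem hh hJ (by simp only [mem_Ici]; linarith) ht
  have hc : ∀ g, Continuous fun t : Icc 0 T => Real.exp (-(l * t)) • (-delayTerm G (u g) t) := by
    intro g
    have h1 : ContinuousOn (delayTerm G (u g)) (Icc 0 T) :=
      (hp g).continuousOn_evalHistory hh hJ (fun ρ _ => ⟨K, fun φ ψ _ _ => hG φ ψ⟩)
        (by simp only [mem_Ici]; linarith)
    have h2 : Continuous fun t : Icc 0 T => delayTerm G (u g) t :=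
      continuousOn_iff_continuous_domRestrict.1 h1
    exact (by fun_prop : Continuous fun t : Icc 0 T => Real.exp (-(l * t))).smul h2.neg
  let Φ : C(Icc 0 T, H) → C(Icc 0 T, H) := fun g => ⟨_, hc g⟩
  have hΦ : ContractingWith (1 / 2) Φ := by
    refine ⟨by norm_num, LipschitzWith.of_dist_le_mul fun g₁ g₂ => ?_⟩
    rw [ContinuousMap.dist_le (by positivity)]
    intro t
    set d := dist g₁ g₂ with hd
    have hd0 : 0 ≤ d := dist_nonneg
    have hUle : ∀ s ∈ Icc 0 (t : ℝ), ‖U g₁ s - U g₂ s‖ ≤ E * (d / l * Real.exp (l * t)) := by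
      intro s hs
      refine (norm_forcedFlow_sub_le (continuous_weighted hT l g₁) (continuous_weighted hT l g₂)
        hs.1 (hs.2.trans t.2.2)).trans ?_
      rw [sub_self, norm_zero, zero_add]
      have h1 := intervalIntegral_le_of_exp_bound (a := 0) (b := d) (l := l)
        (g := fun s => ‖weighted hT l g₁ s - weighted hT l g₂ s‖) hs.1 hl0 hd0
        (((continuous_weighted hT l g₁).sub (continuous_weighted hT l g₂)).norm.continuousOn)
        fun r _ => ?_
      · have h2 : Real.exp (l * s) ≤ Real.exp (l * t) := by
          have := hs.2
          gcongr
        rw [zero_mul, zero_add] at h1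
        have h3 : d / l * Real.exp (l * s) ≤ d / l * Real.exp (l * t) := by gcongr
        gcongr
        exact h1.trans h3
      · rw [weighted, weighted, ← smul_sub, norm_smul, Real.norm_of_nonneg (Real.exp_pos _).le,
          zero_add, mul_comm]
        gcongr
        rw [← dist_eq_norm]
        exact ContinuousMap.dist_apply_le_dist _
    have hdist := distW_history_concat_le forcedFlow_zero forcedFlow_zero (hp g₁) (hp g₂) t.2.1
      (hmem g₁ t.2.1) (hmem g₂ t.2.1) hUle
    change dist (Real.exp (-(l * t)) • (-delayTerm G (u g₁) t))
      (Real.exp (-(l * t)) • (-delayTerm G (u g₂) t)) ≤ _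
    rw [dist_eq_norm, ← smul_sub, norm_smul, Real.norm_of_nonneg (Real.exp_pos _).le,
      delayTerm_eq G (hmem g₁ t.2.1), delayTerm_eq G (hmem g₂ t.2.1), neg_sub_neg,
      norm_sub_rev]
    have h3 := (hG _ _).trans (mul_le_mul_of_nonneg_left hdist hK)
    have h4 : Real.exp (-(l * t)) * Real.exp (l * t) = 1 := by rw [← Real.exp_add]; simp
    calc _ ≤ Real.exp (-(l * t)) * (K * (E * (d / l * Real.exp (l * t)) +
            E * (d / l * Real.exp (l * t)))) := by gcongr
      _ = (Real.exp (-(l * t)) * Real.exp (l * t)) * (2 * K * E / l * d) := by ring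
      _ = 2 * K * E / l * d := by rw [h4, one_mul]
      _ ≤ 1 / 2 * d := by
          refine mul_le_mul_of_nonneg_right ?_ hd0
          rw [div_le_iff₀ hl0, hl]
          linarith
      _ = _ := by simp
  obtain ⟨g, hg⟩ : ∃ g, Φ g = g := ⟨hΦ.fixedPoint, hΦ.fixedPoint_isFixedPt⟩
  refine ⟨u g, ((hp g).mono Icc_subset_Ici_self).isMildSolution hh (isTimeInterval_Icc h hT)
    (fun θ => concatPos_of_mem θ) fun t ht ht0 => ?_⟩
  have hU0 : ∀ s, 0 ≤ s → ((u g s, concatVel hh φ (U g) s) : A.Y) = U g s := fun s hs =>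
    concat_of_nonneg forcedFlow_zero hs
  rw [hU0 t ht0, hU0 0 le_rfl]
  simp only [hU]
  rw [forcedFlow_zero, forcedFlow]
  congr 1
  refine intervalIntegral.integral_congr fun s hs => ?_
  rw [uIcc_of_le ht0] at hs
  have hsT : s ∈ Icc 0 T := ⟨hs.1, hs.2.trans ht.2⟩
  have h5 : weighted hT l g s = -delayTerm G (u g) s := by
    have h6 := congrArg (fun f : C(Icc 0 T, H) => f ⟨s, hsT⟩) hg
    change Real.exp (-(l * s)) • (-delayTerm G (u g) s) = g ⟨s, hsT⟩ at h6
    rw [weighted, projIcc_of_mem hT hsT, ← h6, smul_smul, ← Real.exp_add]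
    simp
  simp only [h5, neg_zero, zero_sub]

/-! ### Truncation -/

/-- A locally Lipschitz and locally bounded function on `W` agrees on a ball with a globally
Lipschitz function. -/
theorem exists_truncation (hh : 0 < h) {N : W A h → H} (hN : HypM1 N)
    (hb : ∀ ρ > 0, ∃ B : ℝ, ∀ φ, normW φ ≤ ρ → ‖N φ‖ ≤ B) {R : ℝ} (hR : 0 < R) :
    ∃ (G : W A h → H) (K : ℝ), 0 ≤ K ∧ (∀ φ ψ, ‖G φ - G ψ‖ ≤ K * distW φ ψ) ∧
      ∀ φ, normW φ ≤ R → G φ = N φ := by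
  obtain ⟨C, hC⟩ := hN (R + 1) (by linarith)
  obtain ⟨B, hB⟩ := hb (R + 1) (by linarith)
  -- A cutoff equal to 1 on the ball of radius `R`, vanishing outside radius `R + 1`, and
  -- 1-Lipschitz in `distW`.
  set χ : W A h → ℝ := fun φ => max 0 (min 1 (R + 1 - normW φ)) with hχ
  have hχ0 : ∀ φ, 0 ≤ χ φ := fun φ => le_max_left _ _
  have hχ1 : ∀ φ, χ φ ≤ 1 := fun φ => max_le zero_le_one (min_le_left _ _)
  have hχd : ∀ φ ψ, |χ φ - χ ψ| ≤ distW φ ψ := by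
    intro φ ψ
    refine le_trans ?_ (abs_normW_sub_le hh φ ψ)
    simp only [hχ]
    rw [max_comm (0 : ℝ), max_comm (0 : ℝ)]
    refine (abs_max_sub_max_le_abs _ _ _).trans ((abs_min_sub_min_le_max _ _ _ _).trans ?_)
    rw [sub_self, abs_zero, max_eq_right (abs_nonneg _), sub_sub_sub_cancel_left, abs_sub_comm]
  have hχout : ∀ φ, R + 1 < normW φ → χ φ = 0 := fun φ hφ =>
    max_eq_left ((min_le_right _ _).trans (by linarith))
  -- When `ψ` lies outside, `χ φ = |χ φ - χ ψ| ≤ distW φ ψ`, so a bound on `N φ` suffices.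
  have hout : ∀ φ ψ : W A h, normW φ ≤ R + 1 → R + 1 < normW ψ →
      ‖χ φ • N φ - χ ψ • N ψ‖ ≤ (|B| + |C|) * distW φ ψ := by
    intro φ ψ hφ hψ
    have h1 := hχd φ ψ
    rw [hχout ψ hψ, sub_zero, abs_of_nonneg (hχ0 φ)] at h1
    rw [hχout ψ hψ, zero_smul, sub_zero, norm_smul, Real.norm_of_nonneg (hχ0 φ)]
    calc χ φ * ‖N φ‖ ≤ distW φ ψ * |B| :=
          mul_le_mul h1 ((hB φ hφ).trans (le_abs_self B)) (norm_nonneg _) (distW_nonneg _ _)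
      _ ≤ _ := by nlinarith [distW_nonneg φ ψ, abs_nonneg C]
  refine ⟨fun φ => χ φ • N φ, |B| + |C|, by positivity, fun φ ψ => ?_, fun φ hφ => ?_⟩
  · rcases le_or_gt (normW φ) (R + 1) with hφ | hφ <;> rcases le_or_gt (normW ψ) (R + 1) with hψ | hψ
    · have h1 : χ φ • N φ - χ ψ • N ψ = (χ φ - χ ψ) • N φ + χ ψ • (N φ - N ψ) := by
        rw [sub_smul, smul_sub]; abel
      simp only [h1]
      refine (norm_add_le _ _).trans ?_
      rw [norm_smul, norm_smul, Real.norm_eq_abs, Real.norm_of_nonneg (hχ0 ψ), add_mul]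
      refine add_le_add ?_ ?_
      · rw [mul_comm]
        exact mul_le_mul ((hB φ hφ).trans (le_abs_self B)) (hχd φ ψ) (abs_nonneg _) (abs_nonneg _)
      · refine (mul_le_of_le_one_left (norm_nonneg _) (hχ1 ψ)).trans ((hC φ ψ hφ hψ).trans ?_)
        exact mul_le_mul_of_nonneg_right (le_abs_self C) (distW_nonneg _ _)
    · exact hout φ ψ hφ hψ
    · rw [norm_sub_rev, distW_comm]; exact hout ψ φ hψ hφ
    · simp only [hχout φ hφ, hχout ψ hψ, zero_smul, sub_self, norm_zero]
      exact mul_nonneg (by positivity) (distW_nonneg _ _)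
  · have : χ φ = 1 := by
      simp only [hχ]
      rw [min_eq_left (by linarith), max_eq_right zero_le_one]
    simp only [this, one_smul]

/-- The total nonlinearity `φ ↦ F(φ(0)) + M(φ)`. -/
def totalForce (hh : 0 < h) (F : A.DHalf → H) (M : W A h → H) (φ : W A h) : H :=
  F (φ.1 ⟨0, zero_mem_Icc_delay hh⟩) + M φ

variable {φ : W A h} {F Fstar : A.DHalf → H} {M : W A h → H} {Pi0 Pi1 : A.DHalf → ℝ}

theorem hypM1_totalForce (hh : 0 < h) (hF1 : HypF1 F) (hM1 : HypM1 M) :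
    HypM1 (totalForce hh F M) := by
  intro ρ hρ
  obtain ⟨L, hL⟩ := hF1 ρ hρ
  obtain ⟨C, hC⟩ := hM1 ρ hρ
  refine ⟨|L| + C, fun φ ψ hφ hψ => ?_⟩
  rw [totalForce, totalForce, add_sub_add_comm, add_mul]
  refine (norm_add_le _ _).trans (add_le_add ?_ (hC φ ψ hφ hψ))
  refine (hL _ _ ((norm_le_normW _ _).trans hφ) ((norm_le_normW _ _).trans hψ)).trans ?_
  exact mul_le_mul (le_abs_self L) (norm_sub_le_distW _ _ _) (norm_nonneg _) (abs_nonneg _)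

theorem exists_norm_totalForce_le (hh : 0 < h) (hF1 : HypF1 F) (hM2 : HypM2 M) :
    ∀ ρ > 0, ∃ B : ℝ, ∀ φ, normW φ ≤ ρ → ‖totalForce hh F M φ‖ ≤ B := by
  intro ρ hρ
  obtain ⟨L, hL⟩ := hF1 ρ hρ
  obtain ⟨M₀, M₁, -, hM₁, hM⟩ := hM2
  refine ⟨‖F 0‖ + |L| * ρ + (M₀ + M₁ * ρ), fun φ hφ => ?_⟩
  refine (norm_add_le _ _).trans (add_le_add ?_ ((hM φ).trans (by gcongr)))
  refine (norm_le_norm_add_norm_sub' _ (F 0)).trans (add_le_add_right ?_ _)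
  have h1 := (norm_le_normW φ ⟨0, zero_mem_Icc_delay hh⟩).trans hφ
  refine (hL _ 0 h1 (by simpa using hρ.le)).trans ?_
  rw [sub_zero]
  exact mul_le_mul (le_abs_self L) h1 (norm_nonneg _) (abs_nonneg _)

/-- A solution of a modified problem solves the original one as long as its histories stay in the
region where the nonlinearities agree. -/
theorem IsMildSolution.of_truncation {S : ℝ → A.Y →L[ℝ] A.Y} (hh : 0 < h) {J : Set ℝ}
    (hJ : IsTimeInterval h J) {G : W A h → H} {R : ℝ}
    (hG : ∀ φ, normW φ ≤ R → G φ = totalForce hh F M φ) {u : ℝ → A.DHalf}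
    (hu : IsMildSolution S (fun _ => 0) G J φ u)
    (hR : ∀ t ∈ J, 0 ≤ t → ∀ hm : history h u t ∈ W A h, normW ⟨history h u t, hm⟩ ≤ R) :
    IsMildSolution S F M J φ u where
  continuousOn := hu.continuousOn
  contDiffOn := hu.contDiffOn
  initial := hu.initial
  duhamel t ht ht0 := by
    rw [hu.duhamel t ht ht0]
    congr 1
    refine intervalIntegral.integral_congr fun s hs => ?_
    rw [uIcc_of_le ht0] at hs
    have hsJ : s ∈ J := hJ.mem hh ht (by linarith [hs.1]) hs.2
    have hm := (hu.isPath hh hJ).history_mem hh hJ hsJ hs.1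
    have h0 : history h u s ⟨0, zero_mem_Icc_delay hh⟩ = u s := congrArg u (add_zero s)
    have h1 : delayTerm G u s = F (u s) + delayTerm M u s := by
      rw [delayTerm_eq G hm, delayTerm_eq M hm, hG _ (hR s hsJ hs.1 hm), totalForce]
      simp only [h0]
    simp only [h1, neg_zero, zero_sub, neg_add']

/-- The a priori bound `R` for position and velocity keeps histories of true solutions below `2R`,
and the force is truncated beyond `2R + 1`. Until its history norm first reaches `2R + 1`, the
truncated solution solves the original problem and so obeys the bound `2R`; by continuity it cannot
jump the gap. -/
theorem exists_isMildSolution_Icc (hh : 0 < h) (hF1 : HypF1 F) (hF2 : HypF2 F Fstar Pi0 Pi1)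
    (hM1 : HypM1 M) (hM2 : HypM2 M) (φ : W A h) {T : ℝ} (hT : 0 ≤ T) :
    ∃ u, IsMildSolution (waveGroup A k) F M (Icc (-h) T) φ u := by
  have hρ : 0 < normW φ + 1 := by linarith [normW_nonneg φ]
  obtain ⟨R, hρR, hR⟩ := exists_bound_of_isMildSolution (k := k) hh hF1 hF2 hM1 hM2 hρ T
  obtain ⟨G, K, hK, hGK, hG⟩ := exists_truncation hh (hypM1_totalForce hh hF1 hM1)
    (exists_norm_totalForce_le hh hF1 hM2) (R := R + R + 1) (by linarith)
  obtain ⟨u, hu⟩ := exists_isMildSolution_of_lipschitz (k := k) hh hK hGK φ hT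
  have hJ := isTimeInterval_Icc h hT
  have hp := hu.isPath hh hJ
  set n := evalHistory (normW (A := A) (h := h)) u with hn
  have hTJ : T ∈ Icc (-h) T := ⟨by linarith, le_rfl⟩
  have hnc : ContinuousOn n (Icc 0 T) := hp.continuousOn_evalHistory hh hJ (fun ρ _ =>
    ⟨1, fun φ ψ _ _ => by rw [one_mul]; exact abs_normW_sub_le hh φ ψ⟩) hTJ
  have hneq : ∀ t (hm : history h u t ∈ W A h), n t = normW ⟨history h u t, hm⟩ := fun t hm =>
    evalHistory_eq _ hm
  have hn0 : n 0 ≤ R := by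
    have : history h u 0 = φ.1 := by
      ext1 θ
      simp only [history, zero_add]
      exact hu.initial θ
    have hm : history h u 0 ∈ W A h := this ▸ φ.2
    have h2 : (⟨history h u 0, hm⟩ : W A h) = φ := Subtype.ext this
    rw [hneq 0 hm, h2]
    linarith
  have hR0 : 0 < R := hρ.trans_le hρR
  have hle : ∀ t ∈ Icc 0 T, n t ≤ R + R + 1 := by
    by_contra! hcon
    obtain ⟨t, ht, htn⟩ := hcon
    set D := Icc 0 T ∩ n ⁻¹' Ici (R + R + 1) with hD
    have hDc : IsCompact D := by
      refine isCompact_Icc.of_isClosed_subset ?_ inter_subset_left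
      exact hnc.preimage_isClosed_of_isClosed isClosed_Icc isClosed_Ici
    have hDn : D.Nonempty := ⟨t, ht, htn.le⟩
    set τ := sInf D with hτ
    have hτD : τ ∈ D := hDc.sInf_mem hDn
    have hτ0 : 0 < τ := by
      refine lt_of_le_of_ne hτD.1.1 fun h0 => ?_
      have : R + R + 1 ≤ n τ := hτD.2
      rw [← h0] at this
      linarith
    have hlt : ∀ s ∈ Ico 0 τ, n s ≤ R + R + 1 := by
      intro s hs
      by_contra! hsn
      exact hs.2.not_ge (csInf_le hDc.bddBelow ⟨⟨hs.1, hs.2.le.trans hτD.1.2⟩, hsn.le⟩)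
    -- The interval is open at `τ`, because agreement with the original force is known only before
    -- `τ`. The a priori bound is uniform over intervals and needs no closed end.
    have hJ' : IsTimeInterval h (Ico (-h) τ) :=
      ⟨ordConnected_Ico, fun s hs => ⟨hs.1, hs.2.trans_lt hτ0⟩, Ico_subset_Icc_self.trans
        Icc_subset_Ici_self⟩
    have hsub : Ico (-h) τ ⊆ Icc (-h) T := fun s hs => ⟨hs.1, hs.2.le.trans hτD.1.2⟩
    have hu' := (hu.mono hh hJ hJ' hsub).of_truncation hh hJ' hG fun s hs hs0 hm => by
      rw [← hneq s hm]; exact hlt s ⟨hs0, hs.2⟩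
    have hbd : ∀ s ∈ Ico 0 τ, n s ≤ R + R := by
      intro s hs
      have hsJ : s ∈ Ico (-h) τ := ⟨by linarith [hs.1], hs.2⟩
      have hp' := hu'.isPath hh hJ'
      have hm := hp'.history_mem hh hJ' hsJ hs.1
      rw [hneq s hm]
      have hb := fun r (hr : r ∈ Icc (-h) s) => hR _ hJ' φ u (by linarith) hu' r
        ⟨hr.1, hr.2.trans_lt hs.2⟩ ((hr.2.trans hs.2.le).trans hτD.1.2)
      exact hp'.normW_history_le hh hJ' hsJ hs.1 hm (fun r hr => (hb r hr).1)
        fun r hr => (hb r hr).2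
    have hτn : R + R + 1 ≤ n τ := hτD.2
    -- A value strictly between `2R` and `2R + 1` is attained before `τ`, against the bound just
    -- obtained.
    obtain ⟨s, hs, hsn⟩ := intermediate_value_Icc hτ0.le
      (hnc.mono (Icc_subset_Icc_right hτD.1.2)) (show R + R + 1 / 2 ∈ Icc (n 0) (n τ) from
        ⟨by linarith, by linarith⟩)
    have hsτ : s ≠ τ := by rintro rfl; linarith
    have := hbd s ⟨hs.1, lt_of_le_of_ne hs.2 hsτ⟩
    linarith
  refine ⟨u, hu.of_truncation hh hJ hG fun t ht ht0 hm => ?_⟩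
  rw [← hneq t hm]
  exact hle t ⟨ht0, ht.2⟩

/-! ### Global solutions -/

/-- Both solutions are restricted to the shorter interval, where uniqueness applies; the velocities
there coincide with those on the original intervals. -/
theorem IsMildSolution.velocity_eq_of_le (hh : 0 < h) (hF1 : HypF1 F)
    (hF2 : HypF2 F Fstar Pi0 Pi1) (hM1 : HypM1 M) (hM2 : HypM2 M) {a b : ℝ} (ha : 0 ≤ a)
    (hb : 0 ≤ b) {u₁ u₂ : ℝ → A.DHalf}
    (hu₁ : IsMildSolution (waveGroup A k) F M (Icc (-h) a) φ u₁)
    (hu₂ : IsMildSolution (waveGroup A k) F M (Icc (-h) b) φ u₂) {t : ℝ} (ht : t ∈ Icc (-h) a)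
    (ht' : t ∈ Icc (-h) b) :
    u₁ t = u₂ t ∧ velocity (Icc (-h) a) u₁ t = velocity (Icc (-h) b) u₂ t := by
  have hJ := isTimeInterval_Icc h (le_min ha hb)
  have hsa : Icc (-h) (min a b) ⊆ Icc (-h) a := Icc_subset_Icc_right (min_le_left _ _)
  have hsb : Icc (-h) (min a b) ⊆ Icc (-h) b := Icc_subset_Icc_right (min_le_right _ _)
  have hJa := isTimeInterval_Icc h ha
  have hJb := isTimeInterval_Icc h hb
  have heq := IsMildSolution.eqOn hh hF1 hF2 hM1 hM2 hJ (hu₁.mono hh hJa hJ hsa)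
    (hu₂.mono hh hJb hJ hsb)
  have htm : t ∈ Icc (-h) (min a b) := ⟨ht.1, le_min ht.2 ht'.2⟩
  refine ⟨heq htm, ?_⟩
  rw [← velocity_mono hh hJa hJ hsa hu₁ htm, ← velocity_mono hh hJb hJ hsb hu₂ htm]
  exact derivWithin_congr (fun s hs => by rw [heq hs]) (by rw [heq htm])

/-- Solutions on `[-h, n+1]` agree on overlaps, so a global function can be defined pointwise.
Continuity and differentiability are local, and Duhamel's formula at `t` only involves times up to
`t`. -/
theorem exists_isMildSolution_Ici (hh : 0 < h) (hF1 : HypF1 F) (hF2 : HypF2 F Fstar Pi0 Pi1)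
    (hM1 : HypM1 M) (hM2 : HypM2 M) (φ : W A h) :
    ∃ u, IsMildSolution (waveGroup A k) F M (Ici (-h)) φ u := by
  have hpos : ∀ n : ℕ, (0 : ℝ) ≤ n + 1 := fun n => by positivity
  choose U hU using fun n : ℕ => exists_isMildSolution_Icc (k := k) hh hF1 hF2 hM1 hM2 φ (hpos n)
  have hJ : ∀ n : ℕ, IsTimeInterval h (Icc (-h) (n + 1)) := fun n => isTimeInterval_Icc h (hpos n)
  -- The solution of index `⌈t⌉₊` lives up to `⌈t⌉₊ + 1 > t`, so its interval is a neighbourhood of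
  -- `t` within `[-h,∞)` and determines the derivative there.
  set u : ℝ → A.DHalf := fun t => U ⌈t⌉₊ t with hu
  set v : ℝ → H := fun t => velocity (Icc (-h) (⌈t⌉₊ + 1)) (U ⌈t⌉₊) t with hv
  have hlt : ∀ t : ℝ, t < ⌈t⌉₊ + 1 := fun t => (Nat.le_ceil t).trans_lt (lt_add_one _)
  have key : ∀ n : ℕ, ∀ t ∈ Icc (-h) (n + 1 : ℝ),
      u t = U n t ∧ v t = velocity (Icc (-h) (n + 1)) (U n) t := fun n t ht =>
    IsMildSolution.velocity_eq_of_le hh hF1 hF2 hM1 hM2 (hpos _) (hpos n) (hU ⌈t⌉₊) (hU n)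
      ⟨ht.1, (hlt t).le⟩ ht
  have hpn : ∀ n : ℕ, IsPath (Icc (-h) (n + 1)) u v := fun n =>
    ((hU n).isPath hh (hJ n)).congr (fun t ht => (key n t ht).1) fun t ht => (key n t ht).2
  have hnhds : ∀ t : ℝ, Icc (-h) (⌈t⌉₊ + 1 : ℝ) ∈ 𝓝[Ici (-h)] t := fun t => by
    rw [← Ici_inter_Iic]
    exact inter_mem self_mem_nhdsWithin (mem_nhdsWithin_of_mem_nhds (Iic_mem_nhds (hlt t)))
  have hmem : ∀ t ∈ Ici (-h), t ∈ Icc (-h) (⌈t⌉₊ + 1 : ℝ) := fun t ht => ⟨ht, (hlt t).le⟩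
  have hp : IsPath (Ici (-h)) u v :=
    ⟨fun t ht => ((hpn ⌈t⌉₊).continuousOn t (hmem t ht)).mono_of_mem_nhdsWithin (hnhds t),
      fun t ht => ((hpn ⌈t⌉₊).continuousOn_vel t (hmem t ht)).mono_of_mem_nhdsWithin (hnhds t),
      fun t ht => ((hpn ⌈t⌉₊).hasDeriv t (hmem t ht)).mono_of_mem_nhdsWithin (hnhds t)⟩
  refine ⟨u, hp.isMildSolution hh (isTimeInterval_Ici h) (fun θ => ?_) fun t ht ht0 => ?_⟩
  · rw [(key 0 θ ⟨θ.2.1, θ.2.2.trans (hpos 0)⟩).1]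
    exact (hU 0).initial θ
  · set n := ⌈t⌉₊ with hn
    have htm := hmem t ht
    have h0m : (0 : ℝ) ∈ Icc (-h) (n + 1 : ℝ) := (hJ n).zero_mem hh
    rw [(key n t htm).1, (key n t htm).2, (key n 0 h0m).1, (key n 0 h0m).2,
      (hU n).duhamel t htm ht0]
    congr 1
    refine intervalIntegral.integral_congr fun s hs => ?_
    rw [uIcc_of_le ht0] at hs
    have hsm : ∀ θ ∈ Icc (-h) 0, s + θ ∈ Icc (-h) (n + 1 : ℝ) := fun θ hθ =>
      ⟨by linarith [hθ.1, hs.1], by linarith [hθ.2, hs.2, htm.2]⟩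
    have hhist : history h (U n) s = history h u s :=
      funext fun θ => ((key n _ (hsm θ θ.2)).1).symm
    have hus : u s = U n s := (key n s ⟨by linarith [hs.1], hs.2.trans htm.2⟩).1
    simp only [delayTerm, hhist, hus]

end Existence

end DelayWave

end

/-! ### The main theorem -/

open DelayWave in
theorem theorem2p1 {H : Type*} [NormedAddCommGroup H] [InnerProductSpace ℝ H] [CompleteSpace H]
    (A : PosDiscreteOp H) (k h : ℝ) (hh : 0 < h)
    (F Fstar : A.DHalf → H) (Pi0 Pi1 : A.DHalf → ℝ) (M : W A h → H)
    (hF1 : HypF1 F) (hF2 : HypF2 F Fstar Pi0 Pi1) (hM1 : HypM1 M) (hM2 : HypM2 M) :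
    -- the semigroup `S t = e^{-t𝒜}` exists; it is determined by its generator `-𝒜`
    ∃ S : ℝ → A.Y →L[ℝ] A.Y, IsC0Semigroup S ∧ IsGenerator S (-(A.blockOp k)) ∧
      -- existence and uniqueness of global mild solutions
      (∀ φ : W A h, ∃ u : ℝ → A.DHalf, IsMildSolution S F M (Set.Ici (-h)) φ u ∧
        ∀ u' : ℝ → A.DHalf, IsMildSolution S F M (Set.Ici (-h)) φ u' →
          Set.EqOn u' u (Set.Ici (-h))) ∧
      -- energy equality
      (∀ J : Set ℝ, IsTimeInterval h J → ∀ (φ : W A h) (u : ℝ → A.DHalf),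
        IsMildSolution S F M J φ u → ∀ t ∈ J, 0 ≤ t →
          energy Pi0 Pi1 (u t) (velocity J u t) + k * ∫ s in (0 : ℝ)..t, ‖velocity J u s‖ ^ 2 =
            energy Pi0 Pi1 (u 0) (velocity J u 0)
              - (∫ s in (0 : ℝ)..t, inner ℝ (Fstar (u s)) (velocity J u s))
              - ∫ s in (0 : ℝ)..t, inner ℝ (delayTerm M u s) (velocity J u s)) ∧
      -- Lipschitz dependence on the initial data
      (∀ ρ > 0, ∀ T > 0, ∃ C : ℝ, ∀ J : Set ℝ, IsTimeInterval h J →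
        ∀ (φ₁ φ₂ : W A h) (u₁ u₂ : ℝ → A.DHalf), normW φ₁ ≤ ρ → normW φ₂ ≤ ρ →
          IsMildSolution S F M J φ₁ u₁ → IsMildSolution S F M J φ₂ u₂ →
          ∀ t ∈ J, 0 ≤ t → t ≤ T →
            ‖A.sqrtOp (u₁ t - u₂ t)‖ + ‖velocity J u₁ t - velocity J u₂ t‖ ≤
              C * distW φ₁ φ₂) := by
  refine ⟨waveGroup A k, isC0Semigroup_waveGroup A k, isGenerator_waveGroup A k, fun φ => ?_,
    fun J hJ φ u hu t ht ht0 => hu.energy_eq hh hF1 hF2 hM1 hJ ht ht0, fun ρ hρ T hT =>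
    exists_lipschitz_of_isMildSolution hh hF1 hF2 hM1 hM2 hρ hT⟩
  obtain ⟨u, hu⟩ := exists_isMildSolution_Ici (k := k) hh hF1 hF2 hM1 hM2 φ
  exact ⟨u, hu, fun u' hu' =>
    IsMildSolution.eqOn hh hF1 hF2 hM1 hM2 (isTimeInterval_Ici h) hu' hu⟩
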